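/- Theorem 1.3. A dyadic interval is an interval $(k2^{-n},(k+1)2^{-n}]\subset(0,1]$ with integers $n\ge 0$ and $0\le k<2^n$; a dyadic rectangle is a product $I\times J$ of two dyadic intervals, and a dyadic square is a dyadic rectangle with $|I|=|J|$. The dyadic distance of two points of $(0,1]$ (respectively of $(0,1]^2$) is the length of the smallest dyadic interval (respectively the side length of the smallest dyadic square) containing both, and $0$ if the two points coincide. Let $h_I=|I|^{-1/2}(1_{I_{\mathrm{left}}}-1_{I_{\mathrm{right}}})$ be the $L^2$-normalized Haar function of $I$, where $I_{\mathrm{left}}$ and $I_{\mathrm{right}}$ are the two halves of $I$. For every $1<p<\infty$ there is a constant $C_p$, depending only on $p$, such that the following holds. Let $v:(0,1]^2\to(0,1]$ take values in $\{2^{-k}:k\in\mathbb{N}\}$, where $\mathbb{N}=\{0,1,2,\dots\}$, and have Lipschitz constant at most $1/2$ with respect to the dyadic distances on $(0,1]^2$ and $(0,1]$. Then for every complex-valued $f\in L^p((0,1]^2)$ the series $$H_{v,D}f(x,y)=\sum_{|J|/|I|\le v(x,y)}\langle f,h_I\otimes h_J\rangle\,h_I(x)h_J(y),$$ over all dyadic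 rectangles $I\times J$ in $(0,1]^2$ satisfying the stated condition, converges unconditionally in $L^p((0,1]^2)$ (the term of $I\times J$ being the function that vanishes at the points $(x,y)$ with $|J|/|I|>v(x,y)$), and $$\|H_{v,D}f\|_p\le C_p\,\|f\|_p .$$ -/

import Mathlib

open MeasureTheory Filter Topology
open scoped ENNReal NNReal

noncomputable section

namespace DyadicModel

/-- A dyadic interval `(k / 2 ^ n, (k + 1) / 2 ^ n]` contained in `(0, 1]`. -/
structure DyadicInterval where
  /-- the generation `n` -/
  level : ℕ
  /-- the position `k`, with `0 ≤ k < 2 ^ n` -/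
  index : Fin (2 ^ level)

namespace DyadicInterval

/-- The length `|I| = 2 ^ (-n)`. -/
def length (I : DyadicInterval) : ℝ := 1 / 2 ^ I.level

/-- The interval as a subset of the line, open on the left and closed on the right. -/
def toSet (I : DyadicInterval) : Set ℝ :=
  Set.Ioc ((I.index : ℕ) * I.length) (((I.index : ℕ) + 1) * I.length)

/-- The left half of the interval. -/
def leftHalf (I : DyadicInterval) : Set ℝ :=
  Set.Ioc ((I.index : ℕ) * I.length) (((I.index : ℕ) + 1 / 2) * I.length)

/-- The right half of the interval. -/
def rightHalf (I : DyadicInterval) : Set ℝ :=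
  Set.Ioc (((I.index : ℕ) + 1 / 2) * I.length) (((I.index : ℕ) + 1) * I.length)

/-- The `L²` normalized Haar function `h_I = |I| ^ (-1/2) (1_{left half} - 1_{right half})`. -/
def haar (I : DyadicInterval) (x : ℝ) : ℝ :=
  (Real.sqrt I.length)⁻¹ *
    (I.leftHalf.indicator (fun _ => 1) x - I.rightHalf.indicator (fun _ => 1) x)

end DyadicInterval

/-- The unit square `(0, 1]²`. -/
def unitSquare : Set (ℝ × ℝ) := Set.Ioc 0 1 ×ˢ Set.Ioc 0 1

/-- Lebesgue measure on the unit square. -/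
def squareMeasure : Measure (ℝ × ℝ) := volume.restrict unitSquare

/-- The dyadic distance of two points of `(0, 1]`: the length of the smallest dyadic interval
containing both (the infimum of these lengths, which is `0` if the points coincide). -/
def dyadicDist (a b : ℝ) : ℝ :=
  sInf {l : ℝ | ∃ I : DyadicInterval, a ∈ I.toSet ∧ b ∈ I.toSet ∧ l = I.length}

/-- The dyadic distance of two points of `(0, 1]²`: the side length of the smallest dyadic square
containing both (the infimum of these side lengths, which is `0` if the points coincide). -/
def dyadicDistSq (P Q : ℝ × ℝ) : ℝ :=
  sInf {l : ℝ | ∃ I J : DyadicInterval, I.length = J.length ∧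
    P ∈ I.toSet ×ˢ J.toSet ∧ Q ∈ I.toSet ×ˢ J.toSet ∧ l = I.length}

/-- The Haar coefficient `⟨f, h_I ⊗ h_J⟩`. -/
def haarCoeff (f : ℝ × ℝ → ℂ) (I J : DyadicInterval) : ℂ :=
  ∫ P in unitSquare, f P * ((I.haar P.1 * J.haar P.2 : ℝ) : ℂ)

open Classical in
/-- The contribution of the rectangle `I × J` to the Haar multiplier:
`⟨f, h_I ⊗ h_J⟩ h_I(x) h_J(y)` where `|J| / |I| ≤ v (x, y)`, and `0` elsewhere. -/
def haarTerm (v : ℝ × ℝ → ℝ) (f : ℝ × ℝ → ℂ) (s : DyadicInterval × DyadicInterval)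
    (P : ℝ × ℝ) : ℂ :=
  if s.2.length / s.1.length ≤ v P then
    haarCoeff f s.1 s.2 * ((s.1.haar P.1 * s.2.haar P.2 : ℝ) : ℂ)
  else 0

/-- `g` is `H_{v,D} f` in `L^p((0, 1]²)`: the series over all dyadic rectangles `I × J` with
`|J| / |I| ≤ v (x, y)` converges to `g` unconditionally in `L^p`, that is, along the net of all
finite sets of rectangles. -/
def IsHaarMultiplier (p : ℝ≥0∞) (v : ℝ × ℝ → ℝ) (f g : ℝ × ℝ → ℂ) : Prop :=
  MemLp g p squareMeasure ∧
    Tendsto (fun S : Finset (DyadicInterval × DyadicInterval) =>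
      eLpNorm (fun P => (∑ s ∈ S, haarTerm v f s P) - g P) p squareMeasure) atTop (𝓝 0)

end DyadicModel

end

/-!
# Boundedness of the dyadic Hilbert transform along a Lipschitz direction field

Write `v = 2 ^ (-κ)`. Two different values `2 ^ (-k)` and `2 ^ (-m)` are at dyadic distance at least
their maximum, so the Lipschitz condition says that `v` is constant on the dyadic square of side
`v P` around each point `P` (`exponent_eq_of_mem_square`). If `F i j` denotes the biparameter
martingale difference of `f` of generations `i` and `j`, then the operator is
`T f = ∑ j, D j` with `D j = ∑_{i ≤ j - κ} F i j`. The condition `i ≤ j - κ` depends on the second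
variable only through its dyadic interval of generation `j`; hence, for a fixed first variable, the
`D j` are martingale differences in the second variable. Being partial sums in `i`, they are bounded
by the martingale maximal function in the first variable. Therefore, in `L^p`,

  `‖T f‖ ≲ ‖(∑ |D j|²)^{1/2}‖ ≤ ‖(∑_j (sup_n |∑_{i<n} F i j|)²)^{1/2}‖`
  `≲ ‖(∑_j |∑_i F i j|²)^{1/2}‖ ≲ ‖(∑_{i,j} |F i j|²)^{1/2}‖ ≲ ‖f‖`,

by the square function bound in the second variable, the `ℓ²`-valued maximal inequality, and square
function bounds in both variables. Restricting the series to a finite set of rectangles decreases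
the double square function pointwise, so the bound is uniform over finite partial sums. Since a
dyadic step function has only finitely many nonzero Haar coefficients `⟨f, h_I ⊗ h_J⟩`, and step
functions are dense, unconditional convergence follows.

The square function bounds `norm_le_squareFunction` and `squareFunction_le_norm` hold for Hilbert
space valued dyadic martingales `x` with square sums `s`. They come from Bellman functions
(`sum_bellman_le`): with `q = p / 2`, the functions `(|x|² + s)^q - 2 s^q` and
`(|x|² + s)^q - a |x|^{2q}` for `q ≤ 1`, and `2 |x|^{2q} - (|x|² + l s)^q` and
`2 s^q - (|x|² + s)^q` for `q ≥ 1`, decrease in the mean along the martingale. The maximal inequality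
`maximal_le_norm` follows the proof of Doob's inequality, with the path integral
`∫ |m|^{p-2} dm` of the vector valued maximal function `m` in place of `m^{p-1}`.

All these estimates are proved on the finite grid of dyadic squares of a fixed generation, where the
martingale structure is encoded by the permutations `flip` of the grid that flip one binary digit.
An `L^p` function is transferred to the grid by averaging over the squares.
-/

namespace DyadicModel

/-! ### Inequalities for powers -/

/-- The constant `3 / 2` may be any number above `1`; being below `2`, it allows absorption in the
proofs of the square function bounds. -/
theorem rpow_add_le_weighted {q : ℝ} (hq : 1 ≤ q) :
    ∃ C : ℝ, 0 ≤ C ∧ ∀ u v : ℝ, 0 ≤ u → 0 ≤ v → (u + v) ^ q ≤ 3 / 2 * u ^ q + C * v ^ q := by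
  have hcont : ContinuousAt (fun z : ℝ => (1 + z) ^ q) 0 := by
    apply ContinuousAt.rpow_const (by fun_prop); right; linarith
  have h1 : ∀ᶠ z in 𝓝 (0 : ℝ), (1 + z) ^ q < 3 / 2 :=
    hcont.eventually_lt continuousAt_const (by norm_num)
  obtain ⟨δ, hδ, hδ'⟩ := Metric.eventually_nhds_iff.1 h1
  refine ⟨(1 + 2 / δ) ^ q, by positivity, fun u v hu hv => ?_⟩
  have hvq : 0 ≤ v ^ q := by positivity
  have huq : 0 ≤ u ^ q := by positivity
  rcases le_or_gt (δ / 2 * u) v with h | h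
  · have : u + v ≤ (1 + 2 / δ) * v := by
      have : u ≤ 2 / δ * v := by
        calc u = 2 / δ * (δ / 2 * u) := by field_simp
          _ ≤ _ := by gcongr
      linarith
    calc (u + v) ^ q ≤ ((1 + 2 / δ) * v) ^ q := by gcongr
      _ = (1 + 2 / δ) ^ q * v ^ q := by rw [Real.mul_rpow (by positivity) hv]
      _ ≤ _ := by linarith
  · have hu0 : 0 < u := by
      by_contra hc
      have : u = 0 := by linarith
      subst this; simp at h; linarith
    have hz : (1 + v / u) ^ q < 3 / 2 := by
      apply hδ'
      rw [Real.dist_eq, sub_zero, abs_of_nonneg (by positivity), div_lt_iff₀ hu0]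
      nlinarith
    calc (u + v) ^ q = (u * (1 + v / u)) ^ q := by congr 1; field_simp
      _ = u ^ q * (1 + v / u) ^ q := by rw [Real.mul_rpow hu (by positivity)]
      _ ≤ u ^ q * (3 / 2) := by gcongr
      _ ≤ _ := by
        have : 0 ≤ (1 + 2 / δ) ^ q * v ^ q := by positivity
        linarith

theorem rpow_sub_rpow_le {q : ℝ} (hq : 1 ≤ q) {a b : ℝ} (ha : 0 ≤ a) (hb : 0 ≤ b) :
    a ^ q - b ^ q ≤ q * a ^ (q - 1) * (a - b) := by
  rcases eq_or_lt_of_le ha with rfl | ha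
  · rw [Real.zero_rpow (by linarith)]
    rcases eq_or_lt_of_le hq with rfl | hq
    · simp
    · rw [Real.zero_rpow (by linarith)]
      have : 0 ≤ b ^ q := by positivity
      simpa using this
  · have h := one_add_mul_self_le_rpow_one_add (s := b / a - 1)
      (by have : 0 ≤ b / a := by positivity
          linarith) hq
    rw [add_sub_cancel, Real.div_rpow hb ha.le] at h
    have haq : 0 < a ^ q := by positivity
    rw [le_div_iff₀ haq] at h
    have h2 : a ^ (q - 1) = a ^ q / a := by rw [Real.rpow_sub_one ha.ne']
    rw [h2]
    have : (1 + q * (b / a - 1)) * a ^ q = a ^ q - q * (a ^ q / a) * (a - b) := by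
      field_simp; ring
    linarith

theorem rpow_midpoint_le {q : ℝ} (hq : 1 ≤ q) {a b : ℝ} (ha : 0 ≤ a) (hb : 0 ≤ b) :
    2 * ((a + b) / 2) ^ q ≤ a ^ q + b ^ q := by
  have h := (convexOn_rpow hq).2 ha hb
    (by norm_num : (0 : ℝ) ≤ 1 / 2) (by norm_num : (0 : ℝ) ≤ 1 / 2) (by norm_num)
  simp only [smul_eq_mul] at h
  rw [show (a + b) / 2 = 1 / 2 * a + 1 / 2 * b by ring]
  linarith

theorem le_rpow_midpoint {q : ℝ} (h0 : 0 ≤ q) (hq : q ≤ 1) {a b : ℝ} (ha : 0 ≤ a) (hb : 0 ≤ b) :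
    a ^ q + b ^ q ≤ 2 * ((a + b) / 2) ^ q := by
  have h := (Real.concaveOn_rpow h0 hq).2 ha hb
    (by norm_num : (0 : ℝ) ≤ 1 / 2) (by norm_num : (0 : ℝ) ≤ 1 / 2) (by norm_num)
  simp only [smul_eq_mul] at h
  rw [show (a + b) / 2 = 1 / 2 * a + 1 / 2 * b by ring]
  linarith

/-- The increments of a convex power increase. -/
theorem rpow_increment_mono {q : ℝ} (hq : 1 ≤ q) {a b t : ℝ} (ha : 0 ≤ a) (hab : a ≤ b)
    (ht : 0 ≤ t) : (a + t) ^ q - a ^ q ≤ (b + t) ^ q - b ^ q := by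
  rcases eq_or_lt_of_le ht with rfl | ht
  · simp
  rcases eq_or_lt_of_le hab with rfl | hab
  · simp
  have hD : 0 < b + t - a := by linarith
  have hb : 0 ≤ b + t := by linarith
  have h1 := (convexOn_rpow hq).2 ha hb (div_nonneg (by linarith) hD.le : 0 ≤ (b - a) / (b + t - a))
    (by positivity : 0 ≤ t / (b + t - a)) (by field_simp; ring)
  have h2 := (convexOn_rpow hq).2 ha hb (by positivity : 0 ≤ t / (b + t - a))
    (div_nonneg (by linarith) hD.le : 0 ≤ (b - a) / (b + t - a)) (by field_simp; ring)
  simp only [smul_eq_mul] at h1 h2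
  have e1 : (b - a) / (b + t - a) * a + t / (b + t - a) * (b + t) = a + t := by field_simp; ring
  have e2 : t / (b + t - a) * a + (b - a) / (b + t - a) * (b + t) = b := by field_simp; ring
  have e3 : (b - a) / (b + t - a) + t / (b + t - a) = 1 := by field_simp; ring
  rw [e1] at h1; rw [e2] at h2
  have : (a + t) ^ q + b ^ q ≤ ((b - a) / (b + t - a) + t / (b + t - a)) * (a ^ q + (b + t) ^ q) := by
    linarith
  rw [e3] at this; linarith

/-- The increments of a concave power decrease. -/
theorem rpow_increment_anti {q : ℝ} (h0 : 0 ≤ q) (hq : q ≤ 1) {a b t : ℝ} (ha : 0 ≤ a)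
    (hab : a ≤ b) (ht : 0 ≤ t) : (b + t) ^ q - b ^ q ≤ (a + t) ^ q - a ^ q := by
  rcases eq_or_lt_of_le ht with rfl | ht
  · simp
  rcases eq_or_lt_of_le hab with rfl | hab
  · simp
  have hD : 0 < b + t - a := by linarith
  have hb : 0 ≤ b + t := by linarith
  have h1 := (Real.concaveOn_rpow h0 hq).2 ha hb (div_nonneg (by linarith) hD.le : 0 ≤ (b - a) / (b + t - a))
    (by positivity : 0 ≤ t / (b + t - a)) (by field_simp; ring)
  have h2 := (Real.concaveOn_rpow h0 hq).2 ha hb (by positivity : 0 ≤ t / (b + t - a))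
    (div_nonneg (by linarith) hD.le : 0 ≤ (b - a) / (b + t - a)) (by field_simp; ring)
  simp only [smul_eq_mul] at h1 h2
  have e1 : (b - a) / (b + t - a) * a + t / (b + t - a) * (b + t) = a + t := by field_simp; ring
  have e2 : t / (b + t - a) * a + (b - a) / (b + t - a) * (b + t) = b := by field_simp; ring
  have e3 : (b - a) / (b + t - a) + t / (b + t - a) = 1 := by field_simp; ring
  rw [e1] at h1; rw [e2] at h2
  have : ((b - a) / (b + t - a) + t / (b + t - a)) * (a ^ q + (b + t) ^ q) ≤ (a + t) ^ q + b ^ q := by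
    linarith
  rw [e3] at this; linarith

/-- A second order upper bound for the symmetric mean of a convex power; the constant comes from
`(1 + u) ^ q ≤ exp (q u)` and `cosh z ≤ exp (z ^ 2 / 2)`. -/
theorem rpow_symm_le {q : ℝ} (hq : 1 ≤ q) {A B : ℝ} (hA : 0 < A) (hB : |B| ≤ A) :
    (A + B) ^ q + (A - B) ^ q
      ≤ 2 * A ^ q + 2 * (Real.exp (q ^ 2 / 2) - 1) * (A ^ q * (B / A) ^ 2) := by
  set u := B / A with hu
  have hu1 : |u| ≤ 1 := by rw [hu, abs_div, abs_of_pos hA, div_le_one hA]; exact hB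
  obtain ⟨hu2, hu3⟩ := abs_le.1 hu1
  have hBu : B = A * u := by rw [hu]; field_simp
  have hu4 : u ^ 2 ≤ 1 := by nlinarith
  have key : ∀ w : ℝ, -1 ≤ w → (1 + w) ^ q ≤ Real.exp (q * w) := by
    intro w hw
    calc (1 + w) ^ q ≤ (Real.exp w) ^ q := by
          apply Real.rpow_le_rpow (by linarith) _ (by linarith)
          linarith [Real.add_one_le_exp w]
      _ = Real.exp (q * w) := by rw [← Real.exp_mul, mul_comm]
  have h1 := key u hu2
  have h2 := key (-u) (by linarith)
  have h3 : Real.exp (q * u) + Real.exp (q * -u) ≤ 2 * Real.exp ((q * u) ^ 2 / 2) := by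
    have := Real.cosh_le_exp_half_sq (q * u)
    rw [Real.cosh_eq] at this
    rw [show q * -u = -(q * u) by ring]; linarith
  have h4 : Real.exp ((q * u) ^ 2 / 2) ≤ 1 + (Real.exp (q ^ 2 / 2) - 1) * u ^ 2 := by
    have := convexOn_exp.2 (Set.mem_univ 0) (Set.mem_univ (q ^ 2 / 2))
      (by linarith : 0 ≤ 1 - u ^ 2) (by positivity : 0 ≤ u ^ 2) (by ring)
    simp only [smul_eq_mul, mul_zero, zero_add, Real.exp_zero] at this
    rw [show (q * u) ^ 2 / 2 = u ^ 2 * (q ^ 2 / 2) by ring]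
    linarith
  have hAq : 0 < A ^ q := by positivity
  rw [hBu, show A + A * u = A * (1 + u) by ring, show A - A * u = A * (1 + -u) by ring,
    Real.mul_rpow hA.le (by linarith), Real.mul_rpow hA.le (by linarith)]
  have h5 : (1 + u) ^ q + (1 + -u) ^ q ≤ 2 + 2 * (Real.exp (q ^ 2 / 2) - 1) * u ^ 2 := by linarith
  nlinarith [mul_le_mul_of_nonneg_left h5 hAq.le]

/-- A second order lower bound for the symmetric mean of a power between `1` and `2`. -/
theorem two_add_le_rpow_symm {p : ℝ} (h1 : 1 < p) (h2 : p ≤ 2) {u : ℝ} (hu0 : 0 ≤ u)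
    (hu1 : u ≤ 1) : 2 + p * (p - 1) / 2 * u ^ 2 ≤ (1 + u) ^ p + (1 - u) ^ p := by
  have hmono : MonotoneOn
      (fun z : ℝ => (1 + z) ^ p + (1 - z) ^ p - p * (p - 1) / 2 * z ^ 2) (Set.Icc 0 1) := by
    apply monotoneOn_of_deriv_nonneg (convex_Icc 0 1)
    · apply ContinuousOn.sub
      · apply ContinuousOn.add
        · exact ContinuousOn.rpow_const (by fun_prop) (fun _ _ => Or.inr (by linarith))
        · exact ContinuousOn.rpow_const (by fun_prop) (fun _ _ => Or.inr (by linarith))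
      · fun_prop
    · intro z hz
      rw [interior_Icc] at hz
      have e1 : HasDerivAt (fun z : ℝ => (1 + z) ^ p) (1 * p * (1 + z) ^ (p - 1)) z :=
        ((hasDerivAt_id z).const_add 1).rpow_const (Or.inr h1.le)
      have e2 : HasDerivAt (fun z : ℝ => (1 - z) ^ p) (-1 * p * (1 - z) ^ (p - 1)) z :=
        ((hasDerivAt_id z).const_sub 1).rpow_const (Or.inr h1.le)
      exact ((e1.add e2).sub (((hasDerivAt_pow 2 z).const_mul
        (p * (p - 1) / 2)))).differentiableAt.differentiableWithinAt
    · intro z hz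
      rw [interior_Icc] at hz
      have e1 : HasDerivAt (fun z : ℝ => (1 + z) ^ p) (1 * p * (1 + z) ^ (p - 1)) z :=
        ((hasDerivAt_id z).const_add 1).rpow_const (Or.inr h1.le)
      have e2 : HasDerivAt (fun z : ℝ => (1 - z) ^ p) (-1 * p * (1 - z) ^ (p - 1)) z :=
        ((hasDerivAt_id z).const_sub 1).rpow_const (Or.inr h1.le)
      have e3 := (e1.add e2).sub (((hasDerivAt_pow 2 z).const_mul (p * (p - 1) / 2)))
      have e4 : deriv (fun z : ℝ => (1 + z) ^ p + (1 - z) ^ p - p * (p - 1) / 2 * z ^ 2) z = _ :=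
        e3.deriv
      rw [e4]
      have b1 : (1 - z) ^ (p - 1) ≤ 1 + (p - 1) * (-z) := by
        have := rpow_one_add_le_one_add_mul_self (s := -z) (p := p - 1) (by linarith [hz.2])
          (by linarith) (by linarith)
        simpa [sub_eq_add_neg] using this
      have b2 : 1 ≤ (1 + z) ^ (p - 1) := Real.one_le_rpow (by linarith [hz.1]) (by linarith)
      have b3 : (p - 1) * z ≤ (1 + z) ^ (p - 1) - (1 - z) ^ (p - 1) := by linarith
      have := mul_le_mul_of_nonneg_left b3 (by linarith : 0 ≤ p)
      norm_num
      nlinarith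
  have := hmono (Set.left_mem_Icc.2 zero_le_one) ⟨hu0, hu1⟩ hu0
  simp only [add_zero, sub_zero, Real.one_rpow] at this
  norm_num at this
  linarith

/-! ### Square functions of dyadic martingales -/

section TwoPoint

variable {H : Type*} [NormedAddCommGroup H] [InnerProductSpace ℝ H]

/-- The parallelogram law and the Cauchy-Schwarz inequality, with `B` twice the inner product. -/
theorem exists_norm_sq_add_sub (x h : H) : ∃ B : ℝ,
    ‖x + h‖ ^ 2 = ‖x‖ ^ 2 + ‖h‖ ^ 2 + B ∧ ‖x - h‖ ^ 2 = ‖x‖ ^ 2 + ‖h‖ ^ 2 - B ∧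
      B ^ 2 ≤ 4 * ‖x‖ ^ 2 * ‖h‖ ^ 2 := by
  refine ⟨2 * inner ℝ x h, ?_, ?_, ?_⟩
  · rw [norm_add_sq_real]; ring
  · rw [norm_sub_sq_real]; ring
  · have := abs_real_inner_le_norm x h
    have := pow_le_pow_left₀ (abs_nonneg _) this 2
    rw [sq_abs] at this
    nlinarith

/-- Concavity along a step for the function that bounds a martingale by its square function when
`q ≤ 1`. -/
theorem two_point_concave {q : ℝ} (h0 : 0 ≤ q) (hq : q ≤ 1) (x h : H) {s : ℝ} (hs : 0 ≤ s) :
    ((‖x + h‖ ^ 2 + (s + ‖h‖ ^ 2)) ^ q - 2 * (s + ‖h‖ ^ 2) ^ q) +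
      ((‖x - h‖ ^ 2 + (s + ‖h‖ ^ 2)) ^ q - 2 * (s + ‖h‖ ^ 2) ^ q) ≤
    2 * ((‖x‖ ^ 2 + s) ^ q - 2 * s ^ q) := by
  obtain ⟨B, h1, h2, -⟩ := exists_norm_sq_add_sub x h
  have hX : 0 ≤ ‖x‖ ^ 2 := by positivity
  have ht : 0 ≤ ‖h‖ ^ 2 := by positivity
  have e1 := le_rpow_midpoint h0 hq (a := ‖x + h‖ ^ 2 + (s + ‖h‖ ^ 2))
    (b := ‖x - h‖ ^ 2 + (s + ‖h‖ ^ 2)) (by positivity) (by positivity)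
  rw [show (‖x + h‖ ^ 2 + (s + ‖h‖ ^ 2) + (‖x - h‖ ^ 2 + (s + ‖h‖ ^ 2))) / 2 =
    ‖x‖ ^ 2 + s + 2 * ‖h‖ ^ 2 by rw [h1, h2]; ring] at e1
  have e2 := rpow_increment_anti h0 hq hs (by linarith : s ≤ ‖x‖ ^ 2 + s)
    (by linarith : 0 ≤ 2 * ‖h‖ ^ 2)
  have e3 := le_rpow_midpoint h0 hq hs (by linarith : 0 ≤ s + 2 * ‖h‖ ^ 2)
  rw [show (s + (s + 2 * ‖h‖ ^ 2)) / 2 = s + ‖h‖ ^ 2 by ring] at e3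
  linarith

/-- Concavity along a step for the function that bounds the square function by the martingale when
`q ≥ 1`. -/
theorem two_point_convex {q : ℝ} (hq : 1 ≤ q) (x h : H) {s : ℝ} (hs : 0 ≤ s) :
    (2 * (s + ‖h‖ ^ 2) ^ q - (‖x + h‖ ^ 2 + (s + ‖h‖ ^ 2)) ^ q) +
      (2 * (s + ‖h‖ ^ 2) ^ q - (‖x - h‖ ^ 2 + (s + ‖h‖ ^ 2)) ^ q) ≤
    2 * (2 * s ^ q - (‖x‖ ^ 2 + s) ^ q) := by
  obtain ⟨B, h1, h2, -⟩ := exists_norm_sq_add_sub x h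
  have hX : 0 ≤ ‖x‖ ^ 2 := by positivity
  have ht : 0 ≤ ‖h‖ ^ 2 := by positivity
  have e1 := rpow_midpoint_le hq (a := ‖x + h‖ ^ 2 + (s + ‖h‖ ^ 2))
    (b := ‖x - h‖ ^ 2 + (s + ‖h‖ ^ 2)) (by positivity) (by positivity)
  rw [show (‖x + h‖ ^ 2 + (s + ‖h‖ ^ 2) + (‖x - h‖ ^ 2 + (s + ‖h‖ ^ 2))) / 2 =
    ‖x‖ ^ 2 + s + 2 * ‖h‖ ^ 2 by rw [h1, h2]; ring] at e1
  have e2 := rpow_increment_mono hq hs (by linarith : s ≤ ‖x‖ ^ 2 + s)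
    (by linarith : 0 ≤ 2 * ‖h‖ ^ 2)
  have e3 := rpow_midpoint_le hq hs (by linarith : 0 ≤ s + 2 * ‖h‖ ^ 2)
  rw [show (s + (s + 2 * ‖h‖ ^ 2)) / 2 = s + ‖h‖ ^ 2 by ring] at e3
  linarith

/-- Concavity along a step for the function that bounds a martingale by its square function when
`q ≥ 1`. By Jensen's inequality the second power gains `l ‖h‖ ^ 2` under the power, which for large
`l` beats the second order growth of `‖x‖ ^ (2 * q)`. -/
theorem two_point_convex_dual {q : ℝ} (hq : 1 ≤ q) : ∃ l : ℝ, 0 ≤ l ∧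
    ∀ {H : Type*} [NormedAddCommGroup H] [InnerProductSpace ℝ H] (x h : H) (s : ℝ), 0 ≤ s →
    (2 * (‖x + h‖ ^ 2) ^ q - (‖x + h‖ ^ 2 + l * (s + ‖h‖ ^ 2)) ^ q) +
      (2 * (‖x - h‖ ^ 2) ^ q - (‖x - h‖ ^ 2 + l * (s + ‖h‖ ^ 2)) ^ q) ≤
    2 * (2 * (‖x‖ ^ 2) ^ q - (‖x‖ ^ 2 + l * s) ^ q) := by
  set K := Real.exp (q ^ 2 / 2) - 1 with hK
  have hK0 : 0 ≤ K := by
    have : 1 ≤ Real.exp (q ^ 2 / 2) := Real.one_le_exp (by positivity)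
    linarith
  refine ⟨(q + 8 * K) / q, by positivity, fun {H} _ _ x h s hs => ?_⟩
  set l := (q + 8 * K) / q with hl
  have hl0 : 0 ≤ l := by positivity
  have hql : q * l = q + 8 * K := by rw [hl]; field_simp
  obtain ⟨B, h1, h2, hB⟩ := exists_norm_sq_add_sub x h
  have hX : 0 ≤ ‖x‖ ^ 2 := by positivity
  have ht : 0 ≤ ‖h‖ ^ 2 := by positivity
  have e1 := rpow_midpoint_le hq (a := ‖x + h‖ ^ 2 + l * (s + ‖h‖ ^ 2))
    (b := ‖x - h‖ ^ 2 + l * (s + ‖h‖ ^ 2)) (by positivity) (by positivity)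
  rw [show (‖x + h‖ ^ 2 + l * (s + ‖h‖ ^ 2) + (‖x - h‖ ^ 2 + l * (s + ‖h‖ ^ 2))) / 2 =
    ‖x‖ ^ 2 + l * s + (1 + l) * ‖h‖ ^ 2 by rw [h1, h2]; ring] at e1
  have e2 := rpow_increment_mono hq hX (by nlinarith : ‖x‖ ^ 2 ≤ ‖x‖ ^ 2 + l * s)
    (by positivity : 0 ≤ (1 + l) * ‖h‖ ^ 2)
  rw [show ‖x‖ ^ 2 + (1 + l) * ‖h‖ ^ 2 = ‖x‖ ^ 2 + ‖h‖ ^ 2 + l * ‖h‖ ^ 2 by ring] at e2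
  suffices (‖x + h‖ ^ 2) ^ q + (‖x - h‖ ^ 2) ^ q ≤
      (‖x‖ ^ 2) ^ q + (‖x‖ ^ 2 + ‖h‖ ^ 2 + l * ‖h‖ ^ 2) ^ q by linarith
  rw [h1, h2]
  generalize ‖x‖ ^ 2 = X at *
  generalize ‖h‖ ^ 2 = t at *
  rcases eq_or_lt_of_le (by linarith : 0 ≤ X + t) with hA | hA
  · have hX0 : X = 0 := by linarith
    have ht0 : t = 0 := by linarith
    subst hX0 ht0
    have : B = 0 := by nlinarith
    subst this
    simp
  have hBA : |B| ≤ X + t := by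
    apply abs_le_of_sq_le_sq _ hA.le
    nlinarith [sq_nonneg (X - t)]
  have e3 := rpow_symm_le hq hA hBA
  have e4 : (X + t) ^ q * (B / (X + t)) ^ 2 ≤ 4 * t * (X + t) ^ (q - 1) := by
    have : (X + t) ^ q = (X + t) ^ (q - 1) * (X + t) := by
      rw [Real.rpow_sub_one hA.ne']; field_simp
    rw [this]
    have hp : 0 ≤ (X + t) ^ (q - 1) := by positivity
    have : (X + t) * (B / (X + t)) ^ 2 ≤ 4 * t := by
      rw [div_pow, ← mul_div_assoc, div_le_iff₀ (by positivity)]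
      nlinarith [mul_nonneg ht ht, mul_nonneg hA.le ht]
    nlinarith
  have e5 := rpow_sub_rpow_le hq hA.le hX
  have e6 := rpow_sub_rpow_le hq hA.le (by positivity : 0 ≤ X + t + l * t)
  have e7 : 2 * K * ((X + t) ^ q * (B / (X + t)) ^ 2) ≤ 2 * K * (4 * t * (X + t) ^ (q - 1)) := by
    gcongr
  have e8 : q * (X + t) ^ (q - 1) * (X + t - (X + t + l * t)) =
      - ((q + 8 * K) * (t * (X + t) ^ (q - 1))) := by rw [← hql]; ring
  rw [e8] at e6
  nlinarith

/-- Concavity along a step for the function that bounds the square function by the martingale when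
`q ≤ 1`. It rests on the uniform convexity of `‖x‖ ^ (2 * q)`, which requires `1 < 2 * q`; the triangle
inequality reduces it to the two numbers `‖x + h‖` and `‖x - h‖`. -/
theorem two_point_concave_dual {q : ℝ} (h0 : 1 / 2 < q) (hq : q ≤ 1) : ∃ a : ℝ, 1 ≤ a ∧
    ∀ {H : Type*} [NormedAddCommGroup H] [InnerProductSpace ℝ H] (x h : H) (s : ℝ), 0 ≤ s →
    ((‖x + h‖ ^ 2 + (s + ‖h‖ ^ 2)) ^ q - a * (‖x + h‖ ^ 2) ^ q) +
      ((‖x - h‖ ^ 2 + (s + ‖h‖ ^ 2)) ^ q - a * (‖x - h‖ ^ 2) ^ q) ≤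
    2 * ((‖x‖ ^ 2 + s) ^ q - a * (‖x‖ ^ 2) ^ q) := by
  set κ := 2 * q * (2 * q - 1) / 2 with hκ
  have hκ0 : 0 < κ := by
    have : 0 < 2 * q - 1 := by linarith
    positivity
  refine ⟨2 + 4 / κ, by have : 0 < 4 / κ := by positivity
                        linarith, fun {H} _ _ x h s hs => ?_⟩
  set a := 2 + 4 / κ with ha
  have haκ : a * κ = 2 * κ + 4 := by rw [ha]; field_simp
  have ha2 : 2 ≤ a := by
    have : 0 < 4 / κ := by positivity
    linarith
  have hq0 : 0 ≤ q := by linarith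
  obtain ⟨B, h1, h2, hB⟩ := exists_norm_sq_add_sub x h
  have hX : 0 ≤ ‖x‖ ^ 2 := by positivity
  have ht : 0 ≤ ‖h‖ ^ 2 := by positivity
  have e1 := le_rpow_midpoint hq0 hq (a := ‖x + h‖ ^ 2 + (s + ‖h‖ ^ 2))
    (b := ‖x - h‖ ^ 2 + (s + ‖h‖ ^ 2)) (by positivity) (by positivity)
  rw [show (‖x + h‖ ^ 2 + (s + ‖h‖ ^ 2) + (‖x - h‖ ^ 2 + (s + ‖h‖ ^ 2))) / 2 =
    ‖x‖ ^ 2 + s + 2 * ‖h‖ ^ 2 by rw [h1, h2]; ring] at e1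
  have e2 := rpow_increment_anti hq0 hq hX (by linarith : ‖x‖ ^ 2 ≤ ‖x‖ ^ 2 + s)
    (by linarith : 0 ≤ 2 * ‖h‖ ^ 2)
  have e3 := le_rpow_midpoint hq0 hq hX (by linarith : 0 ≤ ‖x‖ ^ 2 + 2 * ‖h‖ ^ 2)
  rw [show (‖x‖ ^ 2 + (‖x‖ ^ 2 + 2 * ‖h‖ ^ 2)) / 2 = ‖x‖ ^ 2 + ‖h‖ ^ 2 by ring] at e3
  suffices 4 * ((‖x‖ ^ 2 + ‖h‖ ^ 2) ^ q - (‖x‖ ^ 2) ^ q) ≤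
      a * ((‖x + h‖ ^ 2) ^ q + (‖x - h‖ ^ 2) ^ q - 2 * (‖x‖ ^ 2) ^ q) by linarith
  -- by the symmetry `h ↦ -h` the larger of the two norms may be taken to be `‖x + h‖`
  wlog hord : ‖x - h‖ ≤ ‖x + h‖ generalizing h B
  · have := this (-h) (-B) (by rw [← sub_eq_add_neg, norm_neg, h2]; ring)
      (by rw [sub_neg_eq_add, norm_neg, h1]; ring) (by simpa using hB) (by simp)
      (by simpa [add_comm, ← sub_eq_add_neg] using e1) (by simpa using e2) (by simpa using e3)
      (by simpa [← sub_eq_add_neg] using (not_le.1 hord).le)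
    simpa [← sub_eq_add_neg, add_comm] using this
  have hm : ‖x‖ ≤ (‖x + h‖ + ‖x - h‖) / 2 := by
    have : ‖x + x‖ ≤ ‖x + h‖ + ‖x - h‖ := by
      calc ‖x + x‖ = ‖(x + h) + (x - h)‖ := by congr 1; abel
        _ ≤ _ := norm_add_le _ _
    rw [← two_smul ℝ x, norm_smul] at this
    norm_num at this
    linarith
  have hsum : ‖x + h‖ ^ 2 + ‖x - h‖ ^ 2 = 2 * (‖x‖ ^ 2 + ‖h‖ ^ 2) := by rw [h1, h2]; ring
  have hpow : ∀ z : ℝ, 0 ≤ z → (z ^ 2) ^ q = z ^ (2 * q) := fun z hz => by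
    rw [← Real.rpow_natCast_mul hz]; norm_num
  set m := (‖x + h‖ + ‖x - h‖) / 2 with hm_def
  rcases eq_or_lt_of_le (by positivity : 0 ≤ m) with hm0 | hm0
  · have f1 : ‖x + h‖ = 0 := by linarith [norm_nonneg (x + h), norm_nonneg (x - h)]
    have f2 : ‖x - h‖ = 0 := by linarith [norm_nonneg (x + h), norm_nonneg (x - h)]
    have f3 : ‖x‖ = 0 := by linarith [norm_nonneg x]
    rw [f1, f2, f3] at hsum
    have f4 : ‖h‖ ^ 2 = 0 := by nlinarith
    have : (0 : ℝ) ^ q = 0 := Real.zero_rpow (by linarith)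
    simp [f1, f2, f3, f4, this]
  set u := (‖x + h‖ - ‖x - h‖) / (2 * m) with hu
  have hu0 : 0 ≤ u := div_nonneg (by linarith) (by linarith)
  have hu1 : u ≤ 1 := by
    rw [hu, div_le_one (by linarith)]
    linarith [norm_nonneg (x - h)]
  have g1 : ‖x + h‖ = m * (1 + u) := by rw [hu]; field_simp; linarith
  have g2 : ‖x - h‖ = m * (1 - u) := by rw [hu]; field_simp; linarith
  have g3 : ‖x‖ ^ 2 + ‖h‖ ^ 2 = m ^ 2 * (1 + u ^ 2) := by
    rw [g1, g2] at hsum; linarith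
  have g4 : (1 + u ^ 2) ^ q ≤ 1 + u ^ 2 := by
    have := Real.rpow_le_rpow_of_exponent_le (by nlinarith : 1 ≤ 1 + u ^ 2) hq
    rwa [Real.rpow_one] at this
  have g5 := two_add_le_rpow_symm (by linarith : 1 < 2 * q) (by linarith) hu0 hu1
  have g6 : (‖x‖ ^ 2) ^ q ≤ m ^ (2 * q) := by
    rw [hpow _ (norm_nonneg _)]; gcongr
  have hmq : 0 < m ^ (2 * q) := by positivity
  rw [g3, Real.mul_rpow (by positivity) (by positivity), hpow m hm0.le,
    hpow _ (norm_nonneg (x + h)), hpow _ (norm_nonneg (x - h)), g1, g2, Real.mul_rpow hm0.le (by linarith),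
    Real.mul_rpow hm0.le (by linarith)]
  have g7 := mul_le_mul_of_nonneg_left g4 hmq.le
  have g8 := mul_le_mul_of_nonneg_left (mul_le_mul_of_nonneg_left g5 hmq.le)
    (by linarith : 0 ≤ a)
  rw [← hκ] at g8
  have g9 : a * (m ^ (2 * q) * (2 + κ * u ^ 2)) =
      2 * a * m ^ (2 * q) + (2 * κ + 4) * (m ^ (2 * q) * u ^ 2) := by rw [← haκ]; ring
  have g10 : 0 ≤ κ * (m ^ (2 * q) * u ^ 2) := by positivity
  have g11 := mul_le_mul_of_nonneg_right g6 (by linarith : 0 ≤ 2 * a - 4)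
  linarith

end TwoPoint

section LittlewoodPaley

variable {Ω H : Type*} [NormedAddCommGroup H]

/-- The differences `d 0, …, d (N - 1)` of a dyadic martingale on `Ω`, where the dyadic structure
is given by permutations `σ n`: the map `σ n` exchanges the two halves of every dyadic interval of
generation `n`. Thus `d n` changes sign under `σ n`, and is constant on the intervals of
generation `n + 1`, which is recorded as invariance under all later permutations. -/
structure IsDyadicDiff (N : ℕ) (σ : ℕ → Equiv.Perm Ω) (d : ℕ → Ω → H) : Prop where
  anti : ∀ n < N, ∀ ω, d n (σ n ω) = -d n ω
  inv : ∀ n < N, ∀ m < n, ∀ ω, d m (σ n ω) = d m ω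

theorem sum_le_sum_of_symm [Fintype Ω] (σ : Equiv.Perm Ω) {f g : Ω → ℝ}
    (h : ∀ ω, f ω + f (σ ω) ≤ g ω + g (σ ω)) : ∑ ω, f ω ≤ ∑ ω, g ω := by
  have h1 := Finset.sum_le_sum fun ω (_ : ω ∈ Finset.univ) => h ω
  rw [Finset.sum_add_distrib, Finset.sum_add_distrib, Equiv.sum_comp σ f, Equiv.sum_comp σ g] at h1
  linarith

/-- The Bellman function principle: a function `U` of a point and of a running square sum that is
midpoint concave along martingale steps decreases in the mean along dyadic martingales. -/
theorem sum_bellman_le [Fintype Ω] {N : ℕ} {σ : ℕ → Equiv.Perm Ω} {d : ℕ → Ω → H}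
    (hd : IsDyadicDiff N σ d) {g : Ω → H} (hg : ∀ n < N, ∀ ω, g (σ n ω) = g ω) {U : H → ℝ → ℝ}
    (hU : ∀ x h s, 0 ≤ s → U (x + h) (s + ‖h‖ ^ 2) + U (x - h) (s + ‖h‖ ^ 2) ≤ 2 * U x s) :
    ∑ ω, U (g ω + ∑ i ∈ Finset.range N, d i ω) (∑ i ∈ Finset.range N, ‖d i ω‖ ^ 2) ≤
      ∑ ω, U (g ω) 0 := by
  suffices ∀ n ≤ N, ∑ ω, U (g ω + ∑ i ∈ Finset.range n, d i ω)
      (∑ i ∈ Finset.range n, ‖d i ω‖ ^ 2) ≤ ∑ ω, U (g ω) 0 from this N le_rfl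
  intro n
  induction n with
  | zero => simp
  | succ n ih =>
    intro hn
    refine le_trans (sum_le_sum_of_symm (σ n) fun ω => ?_) (ih (by omega))
    have e1 : ∑ i ∈ Finset.range n, d i (σ n ω) = ∑ i ∈ Finset.range n, d i ω :=
      Finset.sum_congr rfl fun i hi => hd.inv n (by omega) i (Finset.mem_range.1 hi) ω
    have e2 : ∑ i ∈ Finset.range n, ‖d i (σ n ω)‖ ^ 2 = ∑ i ∈ Finset.range n, ‖d i ω‖ ^ 2 :=
      Finset.sum_congr rfl fun i hi => by rw [hd.inv n (by omega) i (Finset.mem_range.1 hi) ω]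
    simp only [Finset.sum_range_succ, e1, e2, hg n (by omega), hd.anti n (by omega), norm_neg]
    have := hU (g ω + ∑ i ∈ Finset.range n, d i ω) (d n ω) (∑ i ∈ Finset.range n, ‖d i ω‖ ^ 2)
      (Finset.sum_nonneg fun _ _ => by positivity)
    simp only [add_assoc, sub_eq_add_neg] at this ⊢
    linarith

/-- A dyadic martingale is controlled in `L^{2q}` by its square function. -/
theorem norm_le_squareFunction {q : ℝ} (hq : 1 / 2 < q) : ∃ C : ℝ, 0 ≤ C ∧
    ∀ {H : Type*} [NormedAddCommGroup H] [InnerProductSpace ℝ H]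
      {Ω : Type} [Fintype Ω] {N : ℕ} {σ : ℕ → Equiv.Perm Ω} {d : ℕ → Ω → H},
      IsDyadicDiff N σ d →
      ∑ ω, (‖∑ i ∈ Finset.range N, d i ω‖ ^ 2) ^ q ≤
        C * ∑ ω, (∑ i ∈ Finset.range N, ‖d i ω‖ ^ 2) ^ q := by
  have hz : (0 : ℝ) ^ q = 0 := Real.zero_rpow (by linarith)
  rcases le_total q 1 with h1 | h1
  · refine ⟨2, by norm_num, fun {H} _ _ {Ω} _ {N σ d} hd => ?_⟩
    have := sum_bellman_le hd (g := 0) (fun _ _ _ => rfl)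
      (U := fun x s => (‖x‖ ^ 2 + s) ^ q - 2 * s ^ q)
      (fun x h s hs => two_point_concave (by linarith) h1 x h hs)
    simp [hz] at this
    rw [← Finset.mul_sum] at this
    refine le_trans (Finset.sum_le_sum fun ω _ => ?_) this
    have : 0 ≤ ∑ i ∈ Finset.range N, ‖d i ω‖ ^ 2 := Finset.sum_nonneg fun _ _ => by positivity
    have : 0 ≤ q := by linarith
    gcongr
    linarith
  · obtain ⟨l, hl, hU⟩ := two_point_convex_dual h1
    obtain ⟨C, hC, hC'⟩ := rpow_add_le_weighted h1
    refine ⟨2 * (C * l ^ q), by positivity, fun {H} _ _ {Ω} _ {N σ d} hd => ?_⟩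
    have h2 := sum_bellman_le hd (g := 0) (fun _ _ _ => rfl)
      (U := fun x s => 2 * (‖x‖ ^ 2) ^ q - (‖x‖ ^ 2 + l * s) ^ q) hU
    simp [hz] at h2
    have h3 : ∑ ω, (‖∑ i ∈ Finset.range N, d i ω‖ ^ 2 +
        l * ∑ i ∈ Finset.range N, ‖d i ω‖ ^ 2) ^ q ≤
        ∑ ω, (3 / 2 * (‖∑ i ∈ Finset.range N, d i ω‖ ^ 2) ^ q +
          C * l ^ q * (∑ i ∈ Finset.range N, ‖d i ω‖ ^ 2) ^ q) := by
      refine Finset.sum_le_sum fun ω _ => ?_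
      have h0 : 0 ≤ ∑ i ∈ Finset.range N, ‖d i ω‖ ^ 2 :=
        Finset.sum_nonneg fun _ _ => by positivity
      have := hC' (‖∑ i ∈ Finset.range N, d i ω‖ ^ 2)
        (l * ∑ i ∈ Finset.range N, ‖d i ω‖ ^ 2) (by positivity) (by positivity)
      rw [Real.mul_rpow hl h0, ← mul_assoc] at this
      exact this
    rw [Finset.sum_add_distrib, ← Finset.mul_sum, ← Finset.mul_sum] at h3
    rw [← Finset.mul_sum] at h2
    linarith

/-- The square function of a dyadic martingale is controlled in `L^{2q}` by the martingale. -/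
theorem squareFunction_le_norm {q : ℝ} (hq : 1 / 2 < q) : ∃ C : ℝ, 0 ≤ C ∧
    ∀ {H : Type*} [NormedAddCommGroup H] [InnerProductSpace ℝ H]
      {Ω : Type} [Fintype Ω] {N : ℕ} {σ : ℕ → Equiv.Perm Ω} {d : ℕ → Ω → H} {g : Ω → H},
      IsDyadicDiff N σ d → (∀ n < N, ∀ ω, g (σ n ω) = g ω) →
      ∑ ω, (∑ i ∈ Finset.range N, ‖d i ω‖ ^ 2) ^ q ≤
        C * ∑ ω, (‖g ω + ∑ i ∈ Finset.range N, d i ω‖ ^ 2) ^ q := by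
  have hz : (0 : ℝ) ^ q = 0 := Real.zero_rpow (by linarith)
  rcases le_total q 1 with h1 | h1
  · obtain ⟨a, ha, hU⟩ := two_point_concave_dual hq h1
    refine ⟨a, by linarith, fun {H} _ _ {Ω} _ {N σ d g} hd hg => ?_⟩
    have h2 := sum_bellman_le hd hg
      (U := fun x s => (‖x‖ ^ 2 + s) ^ q - a * (‖x‖ ^ 2) ^ q) hU
    have h3 : ∑ ω, ((‖g ω‖ ^ 2 + 0) ^ q - a * (‖g ω‖ ^ 2) ^ q) ≤ 0 := by
      refine Finset.sum_nonpos fun ω _ => ?_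
      have : 0 ≤ (‖g ω‖ ^ 2) ^ q := by positivity
      rw [add_zero]; nlinarith
    have h4 := h2.trans h3
    rw [Finset.sum_sub_distrib, ← Finset.mul_sum] at h4
    refine le_trans (Finset.sum_le_sum fun ω _ => ?_) (sub_nonpos.1 h4)
    have : 0 ≤ ∑ i ∈ Finset.range N, ‖d i ω‖ ^ 2 := Finset.sum_nonneg fun _ _ => by positivity
    have : 0 ≤ q := by linarith
    gcongr
    have : 0 ≤ ‖g ω + ∑ i ∈ Finset.range N, d i ω‖ ^ 2 := by positivity
    linarith
  · obtain ⟨C, hC, hC'⟩ := rpow_add_le_weighted h1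
    refine ⟨2 * C, by positivity, fun {H} _ _ {Ω} _ {N σ d g} hd hg => ?_⟩
    have h2 := sum_bellman_le hd hg
      (U := fun x s => 2 * s ^ q - (‖x‖ ^ 2 + s) ^ q)
      (fun x h s hs => two_point_convex h1 x h hs)
    have h3 : ∑ ω, (2 * (0 : ℝ) ^ q - (‖g ω‖ ^ 2 + 0) ^ q) ≤ 0 := by
      refine Finset.sum_nonpos fun ω _ => ?_
      have : 0 ≤ (‖g ω‖ ^ 2) ^ q := by positivity
      rw [add_zero, hz]; linarith
    have h4 := h2.trans h3
    rw [Finset.sum_sub_distrib, ← Finset.mul_sum] at h4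
    have h5 : ∑ ω, (‖g ω + ∑ i ∈ Finset.range N, d i ω‖ ^ 2 +
        ∑ i ∈ Finset.range N, ‖d i ω‖ ^ 2) ^ q ≤
        ∑ ω, (3 / 2 * (∑ i ∈ Finset.range N, ‖d i ω‖ ^ 2) ^ q +
          C * (‖g ω + ∑ i ∈ Finset.range N, d i ω‖ ^ 2) ^ q) := by
      refine Finset.sum_le_sum fun ω _ => ?_
      rw [add_comm (‖g ω + ∑ i ∈ Finset.range N, d i ω‖ ^ 2)]
      exact hC' _ _ (Finset.sum_nonneg fun _ _ => by positivity) (by positivity)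
    rw [Finset.sum_add_distrib, ← Finset.mul_sum, ← Finset.mul_sum] at h5
    linarith

end LittlewoodPaley

/-! ### The vector valued maximal inequality -/

/-- The scalar inequality behind the summation by parts in `norm_sum_smul_sub_le`; the constant blows
up as `r → 0`, that is, as `p → 1`. -/
theorem abs_rpow_sub_mul_le {r : ℝ} (hr : 0 < r) {s S : ℝ} (hs : 0 ≤ s) (hS : s ≤ S) :
    |S ^ (r - 1) - s ^ (r - 1)| * s ≤ (1 + 1 / r) * (S ^ r - s ^ r) := by
  rcases eq_or_lt_of_le hs with rfl | hs
  · rw [mul_zero, Real.zero_rpow hr.ne', sub_zero]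
    positivity
  have hS0 : 0 < S := by linarith
  have e1 : s ^ (r - 1) * s = s ^ r := by rw [Real.rpow_sub_one hs.ne']; field_simp
  have e2 : S ^ (r - 1) * S = S ^ r := by rw [Real.rpow_sub_one hS0.ne']; field_simp
  have h0 : 0 ≤ S ^ r - s ^ r := by
    have : s ^ r ≤ S ^ r := by gcongr
    linarith
  have hr' : 0 ≤ 1 / r * (S ^ r - s ^ r) := by positivity
  rcases le_total 1 r with h | h
  · have : s ^ (r - 1) ≤ S ^ (r - 1) := by
      have : 0 ≤ r - 1 := by linarith
      gcongr
    rw [abs_of_nonneg (by linarith), sub_mul, e1]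
    have : S ^ (r - 1) * s ≤ S ^ (r - 1) * S := by gcongr
    linarith
  · have h1 : S ^ (r - 1) ≤ s ^ (r - 1) :=
      Real.rpow_le_rpow_of_nonpos hs hS (by linarith)
    rw [abs_of_nonpos (by linarith), neg_sub, sub_mul, e1]
    -- the tangent line bound `z ^ r ≤ 1 - r + r z` at `z = s / S`
    have h2 := rpow_one_add_le_one_add_mul_self (s := s / S - 1) (p := r)
      (by have : 0 ≤ s / S := by positivity
          linarith) hr.le h
    rw [add_sub_cancel, Real.div_rpow hs.le hS0.le, div_le_iff₀ (by positivity)] at h2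
    have h3 : S ^ (r - 1) * s = S ^ r * (s / S) := by rw [← e2]; field_simp
    have h4 : s / S ≤ 1 := by rw [div_le_one hS0]; exact hS
    have h5 : 0 < S ^ r := by positivity
    have h6 : 1 / r * (r * (s ^ r - S ^ r * (s / S))) = s ^ r - S ^ r * (s / S) := by field_simp
    have h7 : r * (s ^ r - S ^ r * (s / S)) ≤ r * (S ^ r - s ^ r) + (S ^ r - s ^ r) := by
      nlinarith [mul_nonneg h5.le (sub_nonneg.2 h4)]
    have h8 := mul_le_mul_of_nonneg_left h7 (by positivity : 0 ≤ 1 / r)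
    rw [h6] at h8
    have h9 : 1 / r * (r * (S ^ r - s ^ r) + (S ^ r - s ^ r)) =
      (1 + 1 / r) * (S ^ r - s ^ r) := by field_simp
    rw [h3]; linarith

theorem rpow_sub_one_mul_self {r s : ℝ} (hr : 0 < r) (hs : 0 ≤ s) : s ^ (r - 1) * s = s ^ r := by
  rcases eq_or_lt_of_le hs with rfl | hs
  · rw [mul_zero, Real.zero_rpow hr.ne']
  · rw [Real.rpow_sub_one hs.ne']; field_simp

section Path

variable {H : Type*} [NormedAddCommGroup H]

/-- A discrete path integral `∫ |m| ^ (r - 1) dm` along a path of increasing norm is bounded by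
`|m| ^ r`, even for a vector valued path; this follows from summation by parts. -/
theorem norm_sum_smul_sub_le [NormedSpace ℝ H] {r : ℝ} (hr : 0 < r) {m : ℕ → H} (h0 : m 0 = 0)
    (hm : Monotone fun n => ‖m n‖) (N : ℕ) :
    ‖∑ n ∈ Finset.range N, ‖m (n + 1)‖ ^ (r - 1) • (m (n + 1) - m n)‖ ≤
      (2 + 1 / r) * ‖m N‖ ^ r := by
  have key : ‖‖m N‖ ^ (r - 1) • m N -
      ∑ n ∈ Finset.range N, ‖m (n + 1)‖ ^ (r - 1) • (m (n + 1) - m n)‖ ≤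
      (1 + 1 / r) * ‖m N‖ ^ r := by
    induction N with
    | zero => simp [h0, Real.zero_rpow hr.ne']
    | succ n ih =>
      rw [Finset.sum_range_succ]
      have e : ‖m (n + 1)‖ ^ (r - 1) • m (n + 1) -
          (∑ k ∈ Finset.range n, ‖m (k + 1)‖ ^ (r - 1) • (m (k + 1) - m k) +
            ‖m (n + 1)‖ ^ (r - 1) • (m (n + 1) - m n)) =
          (‖m n‖ ^ (r - 1) • m n -
            ∑ k ∈ Finset.range n, ‖m (k + 1)‖ ^ (r - 1) • (m (k + 1) - m k)) +
          (‖m (n + 1)‖ ^ (r - 1) - ‖m n‖ ^ (r - 1)) • m n := by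
        rw [smul_sub, sub_smul]; abel
      rw [e]
      refine (norm_add_le _ _).trans ?_
      rw [norm_smul, Real.norm_eq_abs]
      have := abs_rpow_sub_mul_le hr (norm_nonneg (m n)) (hm (Nat.le_succ n))
      simp only [Nat.succ_eq_add_one] at this
      linarith
  have h1 := norm_sub_norm_le
    (∑ n ∈ Finset.range N, ‖m (n + 1)‖ ^ (r - 1) • (m (n + 1) - m n)) (‖m N‖ ^ (r - 1) • m N)
  rw [norm_sub_rev] at h1
  have h2 : ‖‖m N‖ ^ (r - 1) • m N‖ = ‖m N‖ ^ r := by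
    rw [norm_smul, Real.norm_of_nonneg (by positivity), rpow_sub_one_mul_self hr (norm_nonneg _)]
  rw [h2] at h1
  linarith

theorem norm_rpow_sub_le_inner [InnerProductSpace ℝ H] {p : ℝ} (hp : 1 < p) (a b : H) :
    ‖b‖ ^ p - ‖a‖ ^ p ≤ p * (‖b‖ ^ (p - 1 - 1) * inner ℝ b (b - a)) := by
  have h1 := rpow_sub_rpow_le hp.le (norm_nonneg b) (norm_nonneg a)
  rw [← rpow_sub_one_mul_self (r := p - 1) (by linarith) (norm_nonneg b)] at h1
  have h2 : ‖b‖ * (‖b‖ - ‖a‖) ≤ inner ℝ b (b - a) := by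
    rw [inner_sub_right, real_inner_self_eq_norm_sq]
    have := real_inner_le_norm b a
    nlinarith
  have h3 : 0 ≤ ‖b‖ ^ (p - 1 - 1) := by positivity
  have h4 := mul_le_mul_of_nonneg_left (mul_le_mul_of_nonneg_left h2 h3)
    (by linarith : 0 ≤ p)
  linarith

/-- A weak form of Young's inequality with a small constant in front of the higher power. -/
theorem mul_rpow_le_weighted {p L x s : ℝ} (hp : 1 < p) (hL : 0 < L) (hx : 0 ≤ x) (hs : 0 ≤ s) :
    x * s ^ (p - 1) ≤ L ^ (p - 1) * x ^ p + s ^ p / L := by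
  have hp1 : 0 < p - 1 := by linarith
  have e : ∀ z : ℝ, 0 ≤ z → z ^ p = z ^ (p - 1) * z := fun z hz => by
    have := rpow_sub_one_mul_self (by linarith : 0 < p) hz
    exact this.symm
  have h1 : 0 ≤ L ^ (p - 1) * x ^ p := by positivity
  have h2 : 0 ≤ s ^ p / L := by positivity
  rcases le_total s (L * x) with h | h
  · calc x * s ^ (p - 1) ≤ x * (L * x) ^ (p - 1) := by gcongr
      _ = L ^ (p - 1) * x ^ p := by rw [Real.mul_rpow hL.le hx, e x hx]; ring
      _ ≤ _ := by linarith
  · have : x ≤ s / L := by rw [le_div_iff₀ hL]; linarith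
    calc x * s ^ (p - 1) ≤ s / L * s ^ (p - 1) := by gcongr
      _ = s ^ p / L := by rw [e s hs]; ring
      _ ≤ _ := by linarith

end Path

section Maximal

variable {Ω H : Type*} [NormedAddCommGroup H]

theorem IsDyadicDiff.sum_apply {N : ℕ} {σ : ℕ → Equiv.Perm Ω} {d : ℕ → Ω → H}
    (hd : IsDyadicDiff N σ d) {n k : ℕ} (hn : n ≤ k) (hk : k < N) (ω : Ω) :
    ∑ i ∈ Finset.range n, d i (σ k ω) = ∑ i ∈ Finset.range n, d i ω :=
  Finset.sum_congr rfl fun i hi => hd.inv k hk i (by have := Finset.mem_range.1 hi; omega) ω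

/-- The norm of a dyadic martingale is a submartingale. -/
theorem IsDyadicDiff.sum_mul_norm_le [Fintype Ω] [NormedSpace ℝ H] {N : ℕ}
    {σ : ℕ → Equiv.Perm Ω} {d : ℕ → Ω → H}
    (hd : IsDyadicDiff N σ d) {φ : Ω → ℝ} (hφ : ∀ ω, 0 ≤ φ ω) {n : ℕ} (hn : n ≤ N)
    (hinv : ∀ k, n ≤ k → k < N → ∀ ω, φ (σ k ω) = φ ω) :
    ∑ ω, φ ω * ‖∑ i ∈ Finset.range n, d i ω‖ ≤ ∑ ω, φ ω * ‖∑ i ∈ Finset.range N, d i ω‖ := by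
  suffices ∀ k, n ≤ k → k ≤ N → ∑ ω, φ ω * ‖∑ i ∈ Finset.range n, d i ω‖ ≤
      ∑ ω, φ ω * ‖∑ i ∈ Finset.range k, d i ω‖ from this N hn le_rfl
  intro k hk
  induction k, hk using Nat.le_induction with
  | base => exact fun _ => le_rfl
  | succ k hk ih =>
    intro hkN
    refine (ih (by omega)).trans (sum_le_sum_of_symm (σ k) fun ω => ?_)
    rw [hinv k hk (by omega), hd.sum_apply le_rfl (by omega), Finset.sum_range_succ,
      Finset.sum_range_succ, hd.sum_apply le_rfl (by omega), hd.anti k (by omega)]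
    set x := ∑ i ∈ Finset.range k, d i ω
    have : ‖x + x‖ ≤ ‖x + d k ω‖ + ‖x + -d k ω‖ := by
      calc ‖x + x‖ = ‖(x + d k ω) + (x + -d k ω)‖ := by congr 1; abel
        _ ≤ _ := norm_add_le _ _
    rw [← two_smul ℝ x, norm_smul] at this
    norm_num at this
    have h2 := mul_le_mul_of_nonneg_left this (hφ ω)
    linarith

/-- The `ℓ²`-valued dyadic maximal inequality of Fefferman and Stein, for martingales. -/
theorem maximal_le_norm (H : Type*) [NormedAddCommGroup H] [NormedSpace ℝ H]
    {q : ℝ} (hq : 1 / 2 < q) : ∃ C : ℝ, 0 ≤ C ∧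
    ∀ {Ω ι : Type} [Fintype Ω] [Fintype ι] {N : ℕ} {σ : ℕ → Equiv.Perm Ω} {d : ι → ℕ → Ω → H},
      (∀ j, IsDyadicDiff N σ (d j)) →
      ∑ ω, (∑ j, partialSups (fun n => ‖∑ i ∈ Finset.range n, d j i ω‖) N ^ 2) ^ q ≤
        C * ∑ ω, (∑ j, ‖∑ i ∈ Finset.range N, d j i ω‖ ^ 2) ^ q := by
  set p := 2 * q with hp
  have hp1 : 1 < p := by linarith
  set K := 2 + 1 / (p - 1) with hK
  have hK0 : 0 < K := by
    have : 0 < p - 1 := by linarith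
    positivity
  set L := 2 * (p * K) with hL
  have hL0 : 0 < L := by positivity
  refine ⟨2 * (p * K) * L ^ (p - 1), by positivity, fun {Ω ι} _ _ {N σ d} hd => ?_⟩
  let x : ℕ → Ω → ι → ℝ := fun n ω j => ‖∑ i ∈ Finset.range n, d j i ω‖
  let X : Ω → EuclideanSpace ℝ ι := fun ω => WithLp.toLp 2 (x N ω)
  let M : Ω → ℕ → EuclideanSpace ℝ ι :=
    fun ω n => WithLp.toLp 2 fun j => partialSups (fun n => x n ω j) n
  have hMapp : ∀ ω n j, M ω n j = partialSups (fun n => x n ω j) n := fun _ _ _ => rfl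
  have hpow : ∀ z : ℝ, 0 ≤ z → (z ^ 2) ^ q = z ^ p := fun z hz => by
    rw [← Real.rpow_natCast_mul hz]; norm_num [hp]
  have hMs : ∀ ω n j, M ω (n + 1) j = M ω n j ⊔ x (n + 1) ω j := fun ω n j =>
    partialSups_add_one (fun n => x n ω j) n
  have hM0' : ∀ ω n j, 0 ≤ M ω n j := fun ω n j =>
    le_trans (norm_nonneg _) (le_partialSups (fun n => x n ω j) n)
  have hM0 : ∀ ω, M ω 0 = 0 := fun ω => by
    ext j
    rw [hMapp]
    simp [x]
  have hle : ∀ ω n j, M ω n j ≤ M ω (n + 1) j := fun ω n j => by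
    rw [hMs]; exact le_sup_left
  have hmono : ∀ ω, Monotone fun n => ‖M ω n‖ := fun ω => by
    refine monotone_nat_of_le_succ fun n => ?_
    rw [EuclideanSpace.norm_eq, EuclideanSpace.norm_eq]
    apply Real.sqrt_le_sqrt
    refine Finset.sum_le_sum fun j _ => ?_
    rw [Real.norm_of_nonneg (hM0' ω n j), Real.norm_of_nonneg (hM0' ω (n + 1) j)]
    have := hM0' ω n j
    have := hle ω n j
    gcongr
  have hMinv : ∀ n k ω, n ≤ k → k < N → M (σ k ω) n = M ω n := fun n k ω hn hk => by
    ext j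
    rw [hMapp, hMapp, partialSups_apply, partialSups_apply]
    refine Finset.sup'_congr _ rfl fun i hi => ?_
    have hi' := Finset.mem_Iic.1 hi
    simp only [x]
    rw [(hd j).sum_apply (by omega) hk]
  let w : Ω → ℕ → ℝ := fun ω n => ‖M ω (n + 1)‖ ^ (p - 1 - 1)
  have hw : ∀ ω n, 0 ≤ w ω n := fun ω n => by positivity
  -- the increments of the maximal function are paired with the martingale at the same time
  have hinc : ∀ ω n, ‖M ω (n + 1)‖ ^ p - ‖M ω n‖ ^ p ≤
      p * ∑ j, w ω n * (M ω (n + 1) j - M ω n j) * x (n + 1) ω j := fun ω n => by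
    refine (norm_rpow_sub_le_inner hp1 _ _).trans (le_of_eq ?_)
    congr 1
    rw [PiLp.inner_apply, Finset.mul_sum]
    refine Finset.sum_congr rfl fun j _ => ?_
    have : M ω (n + 1) j * (M ω (n + 1) j - M ω n j) =
        x (n + 1) ω j * (M ω (n + 1) j - M ω n j) := by
      rw [hMs]
      rcases le_total (M ω n j) (x (n + 1) ω j) with h | h
      · rw [sup_of_le_right h]
      · rw [sup_of_le_left h]; ring
    simp only [RCLike.inner_apply, conj_trivial, PiLp.sub_apply, w]
    linear_combination (‖M ω (n + 1)‖ ^ (p - 1 - 1)) * this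
  have hsub : ∀ n < N, ∀ j, ∑ ω, w ω n * (M ω (n + 1) j - M ω n j) * x (n + 1) ω j ≤
      ∑ ω, w ω n * (M ω (n + 1) j - M ω n j) * x N ω j := fun n hn j =>
    (hd j).sum_mul_norm_le
      (fun ω => mul_nonneg (hw ω n) (sub_nonneg.2 (hle ω n j))) hn fun k hk hkN ω => by
        simp only [w]
        rw [hMinv (n + 1) k ω hk hkN, hMinv n k ω (by omega) hkN]
  have hpt : ∀ ω, ∑ n ∈ Finset.range N, ∑ j, w ω n * (M ω (n + 1) j - M ω n j) * x N ω j ≤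
      K * (‖X ω‖ * ‖M ω N‖ ^ (p - 1)) := fun ω => by
    have e : ∑ n ∈ Finset.range N, ∑ j, w ω n * (M ω (n + 1) j - M ω n j) * x N ω j =
        inner ℝ (X ω) (∑ n ∈ Finset.range N, w ω n • (M ω (n + 1) - M ω n)) := by
      rw [inner_sum]
      refine Finset.sum_congr rfl fun n _ => ?_
      rw [PiLp.inner_apply]
      refine Finset.sum_congr rfl fun j _ => ?_
      simp [X]
    rw [e]
    refine (real_inner_le_norm _ _).trans ?_
    have := norm_sum_smul_sub_le (by linarith : 0 < p - 1) (hM0 ω) (hmono ω) N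
    calc _ ≤ ‖X ω‖ * (K * ‖M ω N‖ ^ (p - 1)) := by gcongr
      _ = _ := by ring
  have hfin : ∑ ω, ‖M ω N‖ ^ p ≤
      ∑ ω, (p * K * L ^ (p - 1) * ‖X ω‖ ^ p + 1 / 2 * ‖M ω N‖ ^ p) := by
    calc ∑ ω, ‖M ω N‖ ^ p
        = ∑ ω, ∑ n ∈ Finset.range N, (‖M ω (n + 1)‖ ^ p - ‖M ω n‖ ^ p) := by
          refine Finset.sum_congr rfl fun ω _ => ?_
          rw [Finset.sum_range_sub (fun n => ‖M ω n‖ ^ p), hM0, norm_zero,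
            Real.zero_rpow (by linarith), sub_zero]
      _ ≤ ∑ ω, ∑ n ∈ Finset.range N,
            p * ∑ j, w ω n * (M ω (n + 1) j - M ω n j) * x (n + 1) ω j := by
          gcongr; exact hinc _ _
      _ = p * ∑ n ∈ Finset.range N, ∑ j,
            ∑ ω, w ω n * (M ω (n + 1) j - M ω n j) * x (n + 1) ω j := by
          simp_rw [← Finset.mul_sum]
          rw [Finset.sum_comm]
          congr 1
          exact Finset.sum_congr rfl fun n _ => Finset.sum_comm
      _ ≤ p * ∑ n ∈ Finset.range N, ∑ j,
            ∑ ω, w ω n * (M ω (n + 1) j - M ω n j) * x N ω j := by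
          refine mul_le_mul_of_nonneg_left (Finset.sum_le_sum fun n hn => ?_) (by linarith)
          exact Finset.sum_le_sum fun j _ => hsub n (Finset.mem_range.1 hn) j
      _ = p * ∑ ω, ∑ n ∈ Finset.range N, ∑ j,
            w ω n * (M ω (n + 1) j - M ω n j) * x N ω j := by
          congr 1
          rw [Finset.sum_comm (s := Finset.univ (α := Ω))]
          exact Finset.sum_congr rfl fun n _ => Finset.sum_comm
      _ ≤ p * ∑ ω, K * (‖X ω‖ * ‖M ω N‖ ^ (p - 1)) := by
          gcongr; exact hpt _
      _ = ∑ ω, p * K * (‖X ω‖ * ‖M ω N‖ ^ (p - 1)) := by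
          rw [Finset.mul_sum]; exact Finset.sum_congr rfl fun ω _ => by ring
      _ ≤ _ := by
          refine Finset.sum_le_sum fun ω _ => ?_
          have h1 := mul_rpow_le_weighted hp1 hL0 (norm_nonneg (X ω)) (norm_nonneg (M ω N))
          have h2 := mul_le_mul_of_nonneg_left h1 (by positivity : 0 ≤ p * K)
          have h3 : p * K * (‖M ω N‖ ^ p / L) = 1 / 2 * ‖M ω N‖ ^ p := by
            rw [hL]; field_simp
          linarith
  rw [Finset.sum_add_distrib, ← Finset.mul_sum, ← Finset.mul_sum] at hfin
  have hMn : ∀ ω, (∑ j, partialSups (fun n => ‖∑ i ∈ Finset.range n, d j i ω‖) N ^ 2) ^ q =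
      ‖M ω N‖ ^ p := fun ω => by
    rw [← hpow _ (norm_nonneg _), EuclideanSpace.norm_sq_eq]
    congr 1
    refine Finset.sum_congr rfl fun j _ => ?_
    rw [Real.norm_eq_abs, sq_abs]
  have hXn : ∀ ω, (∑ j, ‖∑ i ∈ Finset.range N, d j i ω‖ ^ 2) ^ q = ‖X ω‖ ^ p := fun ω => by
    rw [← hpow _ (norm_nonneg _), EuclideanSpace.norm_sq_eq]
    simp [X, x]
  simp_rw [hMn, hXn]
  linarith

end Maximal

/-! ### Truncated double sums -/

section TwoParameter

theorem IsDyadicDiff.toLp {Ω ι : Type*} [Fintype ι] {N : ℕ} {σ : ℕ → Equiv.Perm Ω}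
    {d : ι → ℕ → Ω → ℂ} (hd : ∀ j, IsDyadicDiff N σ (d j)) :
    IsDyadicDiff N σ (fun i ω => (WithLp.toLp 2 fun j => d j i ω : EuclideanSpace ℂ ι)) where
  anti n hn ω := by ext j; simpa using (hd j).anti n hn ω
  inv n hn m hm ω := by ext j; simpa using (hd j).inv n hn m hm ω

/-- The truncated double sums are martingales in the second variable: the truncation `i ≤ j - κ`
of the `j`-th difference is decided by the dyadic interval of generation `j`. Their differences
are partial sums in the first variable, hence controlled by a maximal function. -/
theorem truncated_le_doubleSquareFunction {q : ℝ} (hq : 1 / 2 < q) : ∃ C : ℝ, 0 ≤ C ∧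
    ∀ {Ω : Type} [Fintype Ω] {N : ℕ} {σ : ℕ → Equiv.Perm Ω} {F : ℕ → ℕ → Ω → Ω → ℂ}
      {κ : Ω → Ω → ℕ},
      (∀ j b, IsDyadicDiff N σ (fun i a => F i j a b)) →
      (∀ i a, IsDyadicDiff N σ (fun j b => F i j a b)) →
      (∀ a b, ∀ n < N, (κ a b ≤ n ∨ κ a (σ n b) ≤ n) → κ a (σ n b) = κ a b) →
      ∑ a, ∑ b, (‖∑ j ∈ Finset.range N, ∑ i ∈ Finset.range N,
          if i + κ a b ≤ j then F i j a b else 0‖ ^ 2) ^ q ≤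
        C * ∑ a, ∑ b, (∑ i ∈ Finset.range N, ∑ j : Fin N, ‖F i j a b‖ ^ 2) ^ q := by
  obtain ⟨C₁, hC₁, h₁⟩ := norm_le_squareFunction hq
  obtain ⟨C₂, hC₂, h₂⟩ := maximal_le_norm ℂ hq
  refine ⟨C₁ * (C₂ * C₁), by positivity, fun {Ω} _ {N σ F κ} hF₁ hF₂ hκ => ?_⟩
  let D : Ω → ℕ → Ω → ℂ := fun a j b =>
    ∑ i ∈ Finset.range N, if i + κ a b ≤ j then F i j a b else 0
  have hκ' : ∀ a b, ∀ n < N, ∀ j ≤ n, ∀ i, (i + κ a (σ n b) ≤ j ↔ i + κ a b ≤ j) := by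
    intro a b n hn j hj i
    constructor
    · intro h
      rwa [← hκ a b n hn (Or.inr (by omega))]
    · intro h
      rwa [hκ a b n hn (Or.inl (by omega))]
  have hD : ∀ a, IsDyadicDiff N σ (D a) := fun a => by
    refine ⟨fun n hn b => ?_, fun n hn m hm b => ?_⟩
    · simp only [D]
      rw [← Finset.sum_neg_distrib]
      refine Finset.sum_congr rfl fun i _ => ?_
      simp only [hκ' a b n hn n le_rfl]
      split_ifs
      · exact (hF₂ i a).anti n hn b
      · simp
    · simp only [D]
      refine Finset.sum_congr rfl fun i _ => ?_
      simp only [hκ' a b n hn m hm.le]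
      split_ifs
      · exact (hF₂ i a).inv n hn m hm b
      · rfl
  have hDle : ∀ a b j, ‖D a j b‖ ≤
      partialSups (fun n => ‖∑ i ∈ Finset.range n, F i j a b‖) N := fun a b j => by
    have : D a j b = ∑ i ∈ Finset.range (min N (j + 1 - κ a b)), F i j a b := by
      simp only [D]
      rw [← Finset.sum_filter]
      congr 1
      ext i
      simp only [Finset.mem_filter, Finset.mem_range]
      omega
    rw [this]
    exact le_partialSups_of_le (fun n => ‖∑ i ∈ Finset.range n, F i j a b‖) (min_le_left _ _)
  have hq0 : 0 ≤ q := by linarith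
  calc _ ≤ ∑ a, C₁ * ∑ b, (∑ j ∈ Finset.range N, ‖D a j b‖ ^ 2) ^ q :=
        Finset.sum_le_sum fun a _ => h₁ (hD a)
    _ ≤ ∑ a, C₁ * ∑ b, (∑ j : Fin N,
          partialSups (fun n => ‖∑ i ∈ Finset.range n, F i j a b‖) N ^ 2) ^ q := by
        gcongr with a _ b _
        rw [Finset.sum_range]
        gcongr with j _
        exact hDle a b j
    _ = C₁ * ∑ b, ∑ a, (∑ j : Fin N,
          partialSups (fun n => ‖∑ i ∈ Finset.range n, F i j a b‖) N ^ 2) ^ q := by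
        rw [← Finset.mul_sum, Finset.sum_comm]
    _ ≤ C₁ * ∑ b, C₂ * ∑ a, (∑ j : Fin N, ‖∑ i ∈ Finset.range N, F i j a b‖ ^ 2) ^ q := by
        gcongr with b _
        exact h₂ (d := fun (j : Fin N) i a => F i j a b) fun j => hF₁ j b
    _ ≤ C₁ * ∑ b, C₂ * (C₁ * ∑ a,
          (∑ i ∈ Finset.range N, ∑ j : Fin N, ‖F i j a b‖ ^ 2) ^ q) := by
        gcongr with b _
        have := h₁ (IsDyadicDiff.toLp (d := fun (j : Fin N) i a => F i j a b) fun j => hF₁ j b)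
        simp only [EuclideanSpace.norm_sq_eq] at this
        refine le_trans (le_of_eq ?_) this
        simp
    _ = _ := by
        rw [Finset.sum_comm (s := Finset.univ (α := Ω))]
        simp only [← Finset.mul_sum]
        ring

/-- The double square function of a function of two variables is controlled by the function: the
scalar bound in the second variable is followed by the `ℓ²`-valued bound in the first. The functions
`g` and `c` are the means in the second and in the first variable. -/
theorem doubleSquareFunction_le {q : ℝ} (hq : 1 / 2 < q) : ∃ C : ℝ, 0 ≤ C ∧
    ∀ {Ω : Type} [Fintype Ω] {N : ℕ} {σ : ℕ → Equiv.Perm Ω} {F : ℕ → ℕ → Ω → Ω → ℂ}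
      {G c : ℕ → Ω → Ω → ℂ} {g u : Ω → Ω → ℂ},
      (∀ j b, IsDyadicDiff N σ (fun i a => F i j a b)) →
      (∀ j b, ∀ n < N, ∀ a, c j (σ n a) b = c j a b) →
      (∀ j a b, G j a b = c j a b + ∑ i ∈ Finset.range N, F i j a b) →
      (∀ a, IsDyadicDiff N σ (fun j b => G j a b)) →
      (∀ a, ∀ n < N, ∀ b, g a (σ n b) = g a b) →
      (∀ a b, u a b = g a b + ∑ j ∈ Finset.range N, G j a b) →
      ∑ a, ∑ b, (∑ i ∈ Finset.range N, ∑ j : Fin N, ‖F i j a b‖ ^ 2) ^ q ≤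
        C * ∑ a, ∑ b, (‖u a b‖ ^ 2) ^ q := by
  obtain ⟨C, hC, h⟩ := squareFunction_le_norm hq
  refine ⟨C * C, by positivity, fun {Ω} _ {N σ F G c g u} hF hc hG hGd hg hu => ?_⟩
  calc _ = ∑ b, ∑ a, (∑ i ∈ Finset.range N, ∑ j : Fin N, ‖F i j a b‖ ^ 2) ^ q :=
        Finset.sum_comm
    _ ≤ ∑ b, C * ∑ a, (∑ j : Fin N, ‖G j a b‖ ^ 2) ^ q := by
        gcongr with b _
        have := h (g := fun a => (WithLp.toLp 2 fun j : Fin N => c j a b : EuclideanSpace ℂ (Fin N)))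
          (IsDyadicDiff.toLp (d := fun (j : Fin N) i a => F i j a b) fun j => hF j b)
          (fun n hn a => by ext j; exact hc j b n hn a)
        simp only [EuclideanSpace.norm_sq_eq] at this
        refine this.trans (le_of_eq ?_)
        simp [hG]
    _ = C * ∑ a, ∑ b, (∑ j ∈ Finset.range N, ‖G j a b‖ ^ 2) ^ q := by
        rw [← Finset.mul_sum, Finset.sum_comm]
        simp only [Finset.sum_range]
    _ ≤ C * ∑ a, C * ∑ b, (‖u a b‖ ^ 2) ^ q := by
        gcongr with a _
        simp only [hu]
        exact h (hGd a) (hg a)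
    _ = _ := by rw [← Finset.mul_sum]; ring

end TwoParameter

/-! ### The dyadic grid and its Haar functions -/

section Grid

namespace DyadicInterval

theorem length_pos (I : DyadicInterval) : 0 < I.length := by
  unfold length; positivity

theorem length_mk (n : ℕ) (k : Fin (2 ^ n)) : (DyadicInterval.mk n k).length = 1 / 2 ^ n := rfl

/-- Membership in a dyadic interval, for a point of the `a`-th dyadic interval of generation `N`. -/
theorem mem_Ioc_iff_div_eq {N n : ℕ} (hn : n ≤ N) {a k : ℕ} {x : ℝ}
    (hx : x ∈ Set.Ioc ((a : ℝ) * (1 / 2 ^ N)) ((a + 1) * (1 / 2 ^ N))) :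
    x ∈ Set.Ioc ((k : ℝ) * (1 / 2 ^ n)) ((k + 1) * (1 / 2 ^ n)) ↔ a / 2 ^ (N - n) = k := by
  obtain ⟨m, rfl⟩ := Nat.exists_eq_add_of_le hn
  rw [Nat.add_sub_cancel_left]
  have hm : (0 : ℝ) < 2 ^ m := by positivity
  have hnn : (0 : ℝ) < 2 ^ n := by positivity
  rw [Set.mem_Ioc, mul_one_div, mul_one_div, pow_add, div_lt_iff₀ (by positivity),
    le_div_iff₀ (by positivity)] at hx
  rw [Set.mem_Ioc, mul_one_div, mul_one_div, div_lt_iff₀ hnn, le_div_iff₀ hnn]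
  have hm' : 0 < 2 ^ m := by positivity
  obtain ⟨h1, h2⟩ := hx
  constructor
  · rintro ⟨h3, h4⟩
    have h5 : (k : ℝ) * 2 ^ m < a + 1 := by nlinarith
    have h6 : (a : ℝ) < (k + 1) * 2 ^ m := by nlinarith
    have h7 : k * 2 ^ m < a + 1 := by exact_mod_cast h5
    have h8 : a < (k + 1) * 2 ^ m := by exact_mod_cast h6
    exact Nat.div_eq_of_lt_le (by omega) h8
  · intro h
    have h7 : k * 2 ^ m ≤ a := by rw [← h]; exact Nat.div_mul_le_self a _
    have h8 : a + 1 ≤ (k + 1) * 2 ^ m := by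
      rw [← h, Nat.succ_le_iff, mul_comm]; exact Nat.lt_mul_div_succ a hm'
    have h5 : (k : ℝ) * 2 ^ m ≤ a := by exact_mod_cast h7
    have h6 : (a : ℝ) + 1 ≤ (k + 1) * 2 ^ m := by exact_mod_cast h8
    constructor
    · by_contra hc
      rw [not_lt] at hc
      nlinarith
    · by_contra hc
      rw [not_le] at hc
      nlinarith

/-- The `a`-th dyadic interval of generation `N` is contained in a given interval of an earlier
generation exactly when the leading binary digits of `a` are those of the index. -/
theorem mem_toSet_iff {N : ℕ} {a : Fin (2 ^ N)} {x : ℝ}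
    (hx : x ∈ (DyadicInterval.mk N a).toSet) {I : DyadicInterval} (hI : I.level ≤ N) :
    x ∈ I.toSet ↔ (a : ℕ) / 2 ^ (N - I.level) = I.index :=
  mem_Ioc_iff_div_eq hI hx

end DyadicInterval

/-- The sign pattern of the Haar function with index `k` on the half of generation one higher
with index `r`. -/
noncomputable def haarSign (r k : ℕ) : ℝ := (if r = 2 * k then 1 else 0) - if r = 2 * k + 1 then 1 else 0

theorem haarSign_xor_one (r k : ℕ) : haarSign (r ^^^ 1) k = -haarSign r k := by
  unfold haarSign
  rcases Nat.even_or_odd r with h | h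
  · rw [Nat.xor_one_of_even h]
    obtain ⟨t, rfl⟩ := h
    split_ifs <;> first | omega | norm_num
  · rw [Nat.xor_one_of_odd h]
    obtain ⟨t, rfl⟩ := h
    split_ifs <;> first | omega | norm_num

theorem haarSign_mul_haarSign (r r' : ℕ) : haarSign r (r / 2) * haarSign r' (r / 2) =
    2 * (if r = r' then 1 else 0) - if r / 2 = r' / 2 then 1 else 0 := by
  unfold haarSign
  split_ifs <;> first | omega | norm_num

namespace DyadicInterval

theorem haar_eq_haarSign {N : ℕ} {a : Fin (2 ^ N)} {x : ℝ}
    (hx : x ∈ (DyadicInterval.mk N a).toSet) {I : DyadicInterval} (hI : I.level < N) :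
    I.haar x = (Real.sqrt I.length)⁻¹ * haarSign ((a : ℕ) / 2 ^ (N - (I.level + 1))) I.index := by
  have e : I.length = 2 * (1 / 2 ^ (I.level + 1)) := by
    unfold length; rw [pow_succ]; field_simp
  have h1 := mem_Ioc_iff_div_eq (n := I.level + 1) (k := 2 * I.index) hI hx
  have h2 := mem_Ioc_iff_div_eq (n := I.level + 1) (k := 2 * I.index + 1) hI hx
  classical
  unfold haar haarSign
  congr 2
  · rw [Set.indicator_apply]
    refine if_congr ?_ rfl rfl
    rw [← h1, leftHalf, e]
    push_cast
    ring_nf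
  · rw [Set.indicator_apply]
    refine if_congr ?_ rfl rfl
    rw [← h2, rightHalf, e]
    push_cast
    ring_nf

theorem inv_sqrt_length_sq (I : DyadicInterval) :
    (Real.sqrt I.length)⁻¹ * (Real.sqrt I.length)⁻¹ = 2 ^ I.level := by
  rw [← mul_inv, Real.mul_self_sqrt I.length_pos.le]
  unfold length; simp

theorem haar_eq_zero_of_notMem {I : DyadicInterval} {x : ℝ} (hx : x ∉ I.toSet) : I.haar x = 0 := by
  have h := I.length_pos
  have h1 : x ∉ I.leftHalf := fun hc => hx ⟨hc.1, hc.2.trans (by nlinarith)⟩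
  have h2 : x ∉ I.rightHalf := fun hc => hx ⟨lt_of_le_of_lt (by nlinarith) hc.1, hc.2⟩
  simp [haar, h1, h2]

end DyadicInterval

/-- The right endpoint of the `a`-th dyadic interval of generation `N`, used as a representative
point of this interval. -/
noncomputable def gridPoint (N : ℕ) (a : Fin (2 ^ N)) : ℝ := ((a : ℕ) + 1) * (1 / 2 ^ N)

theorem gridPoint_mem (N : ℕ) (a : Fin (2 ^ N)) :
    gridPoint N a ∈ (DyadicInterval.mk N a).toSet := by
  constructor
  · unfold gridPoint DyadicInterval.length
    gcongr
    simp
  · exact le_rfl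

/-- The dyadic interval of generation `n` that contains the `a`-th interval of generation `N`
(for `n ≤ N`). -/
def ancestor (N n : ℕ) (a : Fin (2 ^ N)) : DyadicInterval where
  level := n
  index := ⟨(a : ℕ) / 2 ^ (N - n), by
    rw [Nat.div_lt_iff_lt_mul (by positivity), ← pow_add]
    exact a.2.trans_le (Nat.pow_le_pow_right (by norm_num) (by omega))⟩

theorem ancestor_eq_iff {N : ℕ} {a : Fin (2 ^ N)} {I : DyadicInterval} (hI : I.level ≤ N) :
    ancestor N I.level a = I ↔ gridPoint N a ∈ I.toSet := by
  rw [DyadicInterval.mem_toSet_iff (gridPoint_mem N a) hI]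
  obtain ⟨n, k⟩ := I
  simp [ancestor, Fin.ext_iff]

/-- The map of the grid of generation `N` that exchanges the halves of every dyadic interval of
generation `n < N`: it flips one binary digit. -/
def flip (N n : ℕ) : Equiv.Perm (Fin (2 ^ N)) :=
  Function.Involutive.toPerm
    (fun a => if h : n < N then
      ⟨(a : ℕ) ^^^ 2 ^ (N - (n + 1)),
        Nat.xor_lt_two_pow a.2 (Nat.pow_lt_pow_right (by norm_num) (by omega))⟩ else a)
    (fun a => by
      by_cases h : n < N
      · simp [h]
      · simp [h])

theorem flip_val {N n : ℕ} (h : n < N) (a : Fin (2 ^ N)) :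
    (flip N n a : ℕ) = (a : ℕ) ^^^ 2 ^ (N - (n + 1)) := by
  simp [flip, Function.Involutive.toPerm, h]

theorem flip_div_of_le {N n m : ℕ} (h : n < N) (hm : m ≤ n) (a : Fin (2 ^ N)) :
    (flip N n a : ℕ) / 2 ^ (N - m) = (a : ℕ) / 2 ^ (N - m) := by
  rw [flip_val h, Nat.xor_div_two_pow,
    Nat.div_eq_of_lt (Nat.pow_lt_pow_right (by norm_num) (by omega)), Nat.xor_zero]

theorem flip_div_succ {N n : ℕ} (h : n < N) (a : Fin (2 ^ N)) :
    (flip N n a : ℕ) / 2 ^ (N - (n + 1)) = (a : ℕ) / 2 ^ (N - (n + 1)) ^^^ 1 := by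
  rw [flip_val h, Nat.xor_div_two_pow, Nat.div_self (by positivity)]

theorem ancestor_flip {N n m : ℕ} (h : n < N) (hm : m ≤ n) (a : Fin (2 ^ N)) :
    ancestor N m (flip N n a) = ancestor N m a := by
  unfold ancestor
  simp only [flip_div_of_le h hm]

theorem haar_flip_self {N : ℕ} {I : DyadicInterval} (hI : I.level < N) (a : Fin (2 ^ N)) :
    I.haar (gridPoint N (flip N I.level a)) = -I.haar (gridPoint N a) := by
  rw [DyadicInterval.haar_eq_haarSign (gridPoint_mem _ _) hI,
    DyadicInterval.haar_eq_haarSign (gridPoint_mem _ _) hI, flip_div_succ hI, haarSign_xor_one]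
  ring

theorem haar_flip_of_lt {N n : ℕ} {I : DyadicInterval} (hI : I.level < n) (hn : n < N)
    (a : Fin (2 ^ N)) :
    I.haar (gridPoint N (flip N n a)) = I.haar (gridPoint N a) := by
  rw [DyadicInterval.haar_eq_haarSign (gridPoint_mem _ _) (hI.trans hn),
    DyadicInterval.haar_eq_haarSign (gridPoint_mem _ _) (hI.trans hn), flip_div_of_le hn hI]

/-- The kernel of the projection onto the Haar functions of generation `i`, which is a difference
of two averaging kernels. -/
theorem haar_kernel_eq {N i : ℕ} (hi : i < N) (a a' : Fin (2 ^ N)) :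
    (ancestor N i a).haar (gridPoint N a) * (ancestor N i a).haar (gridPoint N a') =
      2 ^ (i + 1) * (if (a : ℕ) / 2 ^ (N - (i + 1)) = (a' : ℕ) / 2 ^ (N - (i + 1)) then 1 else 0) -
        2 ^ i * (if (a : ℕ) / 2 ^ (N - i) = (a' : ℕ) / 2 ^ (N - i) then 1 else 0) := by
  rw [DyadicInterval.haar_eq_haarSign (gridPoint_mem _ _) hi,
    DyadicInterval.haar_eq_haarSign (gridPoint_mem _ _) hi]
  have e : ∀ b : ℕ, b / 2 ^ (N - i) = b / 2 ^ (N - (i + 1)) / 2 := fun b => by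
    rw [Nat.div_div_eq_div_mul, ← pow_succ]
    congr 2; omega
  have h := DyadicInterval.inv_sqrt_length_sq (ancestor N i a)
  have e2 : ((ancestor N i a).index : ℕ) = (a : ℕ) / 2 ^ (N - (i + 1)) / 2 := e a
  have e3 : (ancestor N i a).level = i := rfl
  simp only [e2, e3] at h ⊢
  rw [mul_mul_mul_comm, h, haarSign_mul_haarSign, e, e]
  ring

/-- The Haar expansion on the finite grid. -/
theorem grid_haar_expansion {N : ℕ} (u : Fin (2 ^ N) → ℂ) (a : Fin (2 ^ N)) :
    u a = 1 / 2 ^ N * ∑ a', u a' + ∑ i ∈ Finset.range N, 1 / 2 ^ N * ∑ a',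
      (((ancestor N i a).haar (gridPoint N a) * (ancestor N i a).haar (gridPoint N a') : ℝ) : ℂ) *
        u a' := by
  have key : ∀ a' : Fin (2 ^ N), ∑ i ∈ Finset.range N,
      (ancestor N i a).haar (gridPoint N a) * (ancestor N i a).haar (gridPoint N a') =
        2 ^ N * (if a = a' then 1 else 0) - 1 := fun a' => by
    rw [Finset.sum_congr rfl fun i hi => haar_kernel_eq (Finset.mem_range.1 hi) a a',
      Finset.sum_range_sub (fun i => (2 : ℝ) ^ i *
        (if (a : ℕ) / 2 ^ (N - i) = (a' : ℕ) / 2 ^ (N - i) then 1 else 0))]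
    have h0 : ∀ b : Fin (2 ^ N), (b : ℕ) / 2 ^ (N - 0) = 0 := fun b =>
      Nat.div_eq_of_lt (by rw [Nat.sub_zero]; exact b.2)
    rw [h0, h0, if_pos rfl, Nat.sub_self, pow_zero, Nat.div_one, Nat.div_one, pow_zero, mul_one]
    simp only [Fin.ext_iff]
  rw [← Finset.mul_sum, ← mul_add, Finset.sum_comm, ← Finset.sum_add_distrib]
  have : ∀ a', u a' + ∑ i ∈ Finset.range N,
      (((ancestor N i a).haar (gridPoint N a) * (ancestor N i a).haar (gridPoint N a') : ℝ) : ℂ) *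
        u a' = if a = a' then 2 ^ N * u a' else 0 := fun a' => by
    rw [← Finset.sum_mul, ← Complex.ofReal_sum, key]
    split_ifs <;> push_cast <;> ring
  rw [Finset.sum_congr rfl fun a' _ => this a', Finset.sum_ite_eq Finset.univ a,
    if_pos (Finset.mem_univ a)]
  field_simp

end Grid

/-! ### The Haar series on the grid -/

section GridBound

theorem ancestor_level (N n : ℕ) (a : Fin (2 ^ N)) : (ancestor N n a).level = n := rfl

theorem haar_ancestor_flip_self {N n : ℕ} (hn : n < N) (a : Fin (2 ^ N)) :
    (ancestor N n (flip N n a)).haar (gridPoint N (flip N n a)) =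
      -(ancestor N n a).haar (gridPoint N a) := by
  rw [ancestor_flip hn le_rfl]
  exact haar_flip_self (I := ancestor N n a) hn a

theorem haar_ancestor_flip_of_lt {N m n : ℕ} (hm : m < n) (hn : n < N) (a : Fin (2 ^ N)) :
    (ancestor N m (flip N n a)).haar (gridPoint N (flip N n a)) =
      (ancestor N m a).haar (gridPoint N a) := by
  rw [ancestor_flip hn hm.le]
  exact haar_flip_of_lt (I := ancestor N m a) hm hn a

/-- The biparameter martingale difference of generations `i` and `j` of the Haar series with
coefficients `c`, on the grid of generation `N`. At each point it is a single Haar term. -/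
noncomputable def haarDiff (N : ℕ) (c : DyadicInterval → DyadicInterval → ℂ) (i j : ℕ)
    (a b : Fin (2 ^ N)) : ℂ :=
  c (ancestor N i a) (ancestor N j b) *
    (((ancestor N i a).haar (gridPoint N a) * (ancestor N j b).haar (gridPoint N b) : ℝ) : ℂ)

theorem isDyadicDiff_haarDiff_left (N : ℕ) (c : DyadicInterval → DyadicInterval → ℂ) (j : ℕ)
    (b : Fin (2 ^ N)) : IsDyadicDiff N (flip N) (fun i a => haarDiff N c i j a b) where
  anti n hn a := by
    simp only [haarDiff]
    rw [haar_ancestor_flip_self hn, ancestor_flip hn le_rfl]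
    push_cast; ring
  inv n hn m hm a := by
    simp only [haarDiff]
    rw [haar_ancestor_flip_of_lt hm hn, ancestor_flip hn hm.le]

theorem isDyadicDiff_haarDiff_right (N : ℕ) (c : DyadicInterval → DyadicInterval → ℂ) (i : ℕ)
    (a : Fin (2 ^ N)) : IsDyadicDiff N (flip N) (fun j b => haarDiff N c i j a b) where
  anti n hn b := by
    simp only [haarDiff]
    rw [haar_ancestor_flip_self hn, ancestor_flip hn le_rfl]
    push_cast; ring
  inv n hn m hm b := by
    simp only [haarDiff]
    rw [haar_ancestor_flip_of_lt hm hn, ancestor_flip hn hm.le]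

/-- The Haar coefficient of a function on the grid of generation `N`. -/
noncomputable def gridCoeff (N : ℕ) (u : Fin (2 ^ N) → Fin (2 ^ N) → ℂ) (I J : DyadicInterval) : ℂ :=
  1 / 2 ^ N * ∑ a, 1 / 2 ^ N * ∑ b,
    u a b * ((I.haar (gridPoint N a) * J.haar (gridPoint N b) : ℝ) : ℂ)

/-- The double square function of the Haar expansion is controlled by the function, by applying
the one parameter bound in each variable. -/
theorem grid_doubleSquareFunction_le {q : ℝ} (hq : 1 / 2 < q) : ∃ C : ℝ, 0 ≤ C ∧
    ∀ (N : ℕ) (u : Fin (2 ^ N) → Fin (2 ^ N) → ℂ),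
      ∑ a, ∑ b, (∑ i ∈ Finset.range N, ∑ j : Fin N,
          ‖haarDiff N (gridCoeff N u) i j a b‖ ^ 2) ^ q ≤
        C * ∑ a, ∑ b, (‖u a b‖ ^ 2) ^ q := by
  obtain ⟨C, hC, h⟩ := doubleSquareFunction_le hq
  refine ⟨C, hC, fun N u => ?_⟩
  let G : ℕ → Fin (2 ^ N) → Fin (2 ^ N) → ℂ := fun j a b => 1 / 2 ^ N * ∑ b',
    (((ancestor N j b).haar (gridPoint N b) * (ancestor N j b).haar (gridPoint N b') : ℝ) : ℂ) *
      u a b'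
  refine h (σ := flip N) (F := haarDiff N (gridCoeff N u)) (G := G)
    (c := fun j _ b => 1 / 2 ^ N * ∑ a', G j a' b) (g := fun a _ => 1 / 2 ^ N * ∑ b', u a b')
    (u := u) (fun j b => isDyadicDiff_haarDiff_left N _ j b) (fun _ _ _ _ _ => rfl)
    (fun j a b => ?_) (fun a => ?_) (fun _ _ _ _ => rfl)
    (fun a b => grid_haar_expansion (u a) b)
  · refine (grid_haar_expansion (fun a => G j a b) a).trans ?_
    congr 1
    refine Finset.sum_congr rfl fun i _ => ?_
    simp only [haarDiff, gridCoeff, G]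
    rw [mul_assoc, Finset.sum_mul]
    congr 1
    refine Finset.sum_congr rfl fun a' _ => ?_
    rw [mul_left_comm, mul_assoc]
    congr 1
    rw [Finset.mul_sum, Finset.sum_mul]
    refine Finset.sum_congr rfl fun b' _ => ?_
    push_cast; ring
  · refine ⟨fun n hn b => ?_, fun n hn m hm b => ?_⟩
    · simp only [G]
      rw [haar_ancestor_flip_self hn, ancestor_flip hn le_rfl, ← mul_neg, ← Finset.sum_neg_distrib]
      congr 1
      refine Finset.sum_congr rfl fun b' _ => ?_
      push_cast; ring
    · simp only [G]
      rw [haar_ancestor_flip_of_lt hm hn, ancestor_flip hn hm.le]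

open Classical in
/-- At a grid point, the Haar terms that do not vanish are indexed by pairs of generations, which turns
a sum over rectangles into a double sum of martingale differences. -/
theorem sum_haar_eq_sum_haarDiff {N : ℕ} (c : DyadicInterval → DyadicInterval → ℂ)
    {S : Finset (DyadicInterval × DyadicInterval)}
    (hS : ∀ s ∈ S, s.1.level < N ∧ s.2.level < N) (k : ℕ) (a b : Fin (2 ^ N)) :
    ∑ s ∈ S, (if s.1.level + k ≤ s.2.level then
        c s.1 s.2 * ((s.1.haar (gridPoint N a) * s.2.haar (gridPoint N b) : ℝ) : ℂ) else 0) =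
      ∑ j ∈ Finset.range N, ∑ i ∈ Finset.range N,
        if i + k ≤ j then haarDiff N (fun I J => if (I, J) ∈ S then c I J else 0) i j a b
        else 0 := by
  set g : DyadicInterval × DyadicInterval → ℂ := fun s => if s.1.level + k ≤ s.2.level then
        c s.1 s.2 * ((s.1.haar (gridPoint N a) * s.2.haar (gridPoint N b) : ℝ) : ℂ) else 0 with hg
  let e : ℕ × ℕ → DyadicInterval × DyadicInterval := fun x =>
    (ancestor N x.2 a, ancestor N x.1 b)
  have he : Function.Injective e := by
    rintro ⟨i, j⟩ ⟨i', j'⟩ h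
    have h1 := congrArg (fun s => s.1.level) h
    have h2 := congrArg (fun s => s.2.level) h
    simp only [e, ancestor_level] at h1 h2
    rw [h1, h2]
  rw [← Finset.sum_product']
  have h1 : ∀ x ∈ Finset.range N ×ˢ Finset.range N, (if x.2 + k ≤ x.1 then
      haarDiff N (fun I J => if (I, J) ∈ S then c I J else 0) x.2 x.1 a b else 0) =
      if e x ∈ S then g (e x) else 0 := by
    intro x _
    simp only [haarDiff, hg, e, ancestor_level]
    split_ifs <;> simp <;> (intro _; omega)
  rw [Finset.sum_congr rfl h1, ← Finset.sum_image (f := fun s => if s ∈ S then g s else 0)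
    (g := e) he.injOn, Finset.sum_ite_mem]
  symm
  refine Finset.sum_subset Finset.inter_subset_right fun s hs hs' => ?_
  by_contra hne
  apply hs'
  rw [Finset.mem_inter]
  refine ⟨Finset.mem_image.2 ⟨(s.2.level, s.1.level), ?_, ?_⟩, hs⟩
  · simp [hS s hs]
  · have ha : gridPoint N a ∈ s.1.toSet := by
      by_contra hc
      exact hne (by simp [hg, DyadicInterval.haar_eq_zero_of_notMem hc])
    have hb : gridPoint N b ∈ s.2.toSet := by
      by_contra hc
      exact hne (by simp [hg, DyadicInterval.haar_eq_zero_of_notMem hc])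
    simp only [e]
    rw [(ancestor_eq_iff (hS s hs).1.le).2 ha, (ancestor_eq_iff (hS s hs).2.le).2 hb]

/-- The truncated Haar series with finitely many terms is bounded on the grid, with a constant that
depends neither on the grid nor on the set of terms. -/
theorem grid_truncated_le {q : ℝ} (hq : 1 / 2 < q) : ∃ C : ℝ, 0 ≤ C ∧
    ∀ (N : ℕ) (u : Fin (2 ^ N) → Fin (2 ^ N) → ℂ) (S : Finset (DyadicInterval × DyadicInterval))
      (κ : Fin (2 ^ N) → Fin (2 ^ N) → ℕ),
      (∀ s ∈ S, s.1.level < N ∧ s.2.level < N) →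
      (∀ a b, ∀ n < N, (κ a b ≤ n ∨ κ a (flip N n b) ≤ n) → κ a (flip N n b) = κ a b) →
      ∑ a, ∑ b, (‖∑ s ∈ S, if s.1.level + κ a b ≤ s.2.level then gridCoeff N u s.1 s.2 *
          ((s.1.haar (gridPoint N a) * s.2.haar (gridPoint N b) : ℝ) : ℂ) else 0‖ ^ 2) ^ q ≤
        C * ∑ a, ∑ b, (‖u a b‖ ^ 2) ^ q := by
  classical
  obtain ⟨C₁, hC₁, h₁⟩ := truncated_le_doubleSquareFunction hq
  obtain ⟨C₂, hC₂, h₂⟩ := grid_doubleSquareFunction_le hq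
  refine ⟨C₁ * C₂, by positivity, fun N u S κ hS hκ => ?_⟩
  simp only [sum_haar_eq_sum_haarDiff (gridCoeff N u) hS]
  refine (h₁ (isDyadicDiff_haarDiff_left N _) (isDyadicDiff_haarDiff_right N _) hκ).trans ?_
  rw [mul_assoc]
  refine mul_le_mul_of_nonneg_left ((?_ : _ ≤ _).trans (h₂ N u)) hC₁
  have hq0 : 0 ≤ q := by linarith
  gcongr with a _ b _ i _ j _
  -- removing terms from the series makes each martingale difference smaller
  simp only [haarDiff, norm_mul]
  gcongr
  split_ifs <;> simp

end GridBound

/-! ### The Lipschitz condition and dyadic squares -/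

section Lipschitz

/-- Since `1 / 2 ^ k` is the right endpoint of its short dyadic intervals, the distance between two
different negative powers of two is at least each of them. -/
theorem le_dyadicDist_of_ne {k m : ℕ} (h : k ≠ m) :
    (1 : ℝ) / 2 ^ k ≤ dyadicDist (1 / 2 ^ k) (1 / 2 ^ m) := by
  have hmem : ∀ n : ℕ, (1 : ℝ) / 2 ^ n ∈ (DyadicInterval.mk 0 0).toSet := fun n => by
    have : (1 : ℝ) / 2 ^ n ≤ 1 := by
      rw [div_le_one (by positivity)]; exact one_le_pow₀ (by norm_num)
    simpa [DyadicInterval.toSet, DyadicInterval.length] using this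
  refine le_csInf ⟨_, DyadicInterval.mk 0 0, hmem k, hmem m, rfl⟩ ?_
  rintro l ⟨⟨n, c⟩, hk, hm, rfl⟩
  rw [DyadicInterval.length_mk]
  by_contra hlt
  rw [not_le, one_div_lt_one_div (by positivity) (by positivity)] at hlt
  have hkn : k < n := (pow_lt_pow_iff_right₀ (by norm_num)).1 hlt
  obtain ⟨e, rfl⟩ := Nat.exists_eq_add_of_lt hkn
  have hpw : (2 : ℝ) ^ (k + e + 1) = 2 ^ k * 2 ^ (e + 1) := by ring
  -- the interval is too short to contain both points, since `1 / 2 ^ k` is its right endpoint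
  have hce : ((c : ℕ) : ℝ) + 1 = 2 ^ (e + 1) := by
    have h1 := hk.1
    have h2 := hk.2
    simp only [DyadicInterval.length_mk] at h1 h2
    rw [mul_one_div, hpw,
      div_lt_div_iff₀ (by positivity) (by positivity), one_mul, mul_comm,
      mul_lt_mul_iff_right₀ (by positivity)] at h1
    rw [mul_one_div, hpw,
      div_le_div_iff₀ (by positivity) (by positivity), one_mul, mul_comm (_ + 1),
      mul_le_mul_iff_right₀ (by positivity)] at h2
    have h1' : (c : ℕ) < 2 ^ (e + 1) := by exact_mod_cast h1
    have h2' : 2 ^ (e + 1) ≤ (c : ℕ) + 1 := by exact_mod_cast h2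
    have : (c : ℕ) + 1 = 2 ^ (e + 1) := by omega
    exact_mod_cast this
  have e1 : ((2 : ℝ) ^ (e + 1)) * (1 / 2 ^ (k + e + 1)) = 1 / 2 ^ k := by
    rw [hpw]; field_simp
  have e2 : (2 : ℝ) * (1 / 2 ^ (k + e + 1)) ≤ 1 / 2 ^ k := by
    rw [← e1]
    gcongr
    exact le_self_pow₀ (by norm_num) (by omega)
  have h3 := hm.1
  have h4 := hm.2
  simp only [DyadicInterval.length_mk] at h3 h4
  rw [hce, e1] at h4
  have h5 : ((c : ℕ) : ℝ) * (1 / 2 ^ (k + e + 1)) = 1 / 2 ^ k - 1 / 2 ^ (k + e + 1) := by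
    rw [← e1, ← hce]; ring
  rw [h5] at h3
  rw [one_div_le_one_div (by positivity) (by positivity),
    pow_le_pow_iff_right₀ (by norm_num)] at h4
  have h6 : k + 1 ≤ m := by omega
  have h7 : (1 : ℝ) / 2 ^ m ≤ 1 / 2 ^ (k + 1) := by
    rw [one_div_le_one_div (by positivity) (by positivity)]
    exact pow_le_pow_right₀ (by norm_num) h6
  have h8 : (1 : ℝ) / 2 ^ (k + 1) = 1 / 2 ^ k / 2 := by rw [pow_succ]; field_simp
  linarith

theorem dyadicDistSq_le {P Q : ℝ × ℝ} {I J : DyadicInterval} (h : I.level = J.level)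
    (hP : P ∈ I.toSet ×ˢ J.toSet) (hQ : Q ∈ I.toSet ×ˢ J.toSet) :
    dyadicDistSq P Q ≤ I.length := by
  refine csInf_le ⟨0, ?_⟩ ⟨I, J, by simp [DyadicInterval.length, h], hP, hQ, rfl⟩
  rintro l ⟨I', -, -, -, -, rfl⟩
  exact I'.length_pos.le

/-- If `v = 1 / 2 ^ κ` is Lipschitz with constant `1 / 2` for the dyadic distances, then `v` is
constant on the dyadic square of side `1 / 2 ^ n` as soon as `v ≥ 1 / 2 ^ n` at one of its points. -/
theorem exponent_eq_of_mem_square {v : ℝ × ℝ → ℝ} {κ : ℝ × ℝ → ℕ}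
    (hκ : ∀ P ∈ unitSquare, v P = 1 / 2 ^ κ P)
    (hL : ∀ P ∈ unitSquare, ∀ Q ∈ unitSquare,
      dyadicDist (v P) (v Q) ≤ 1 / 2 * dyadicDistSq P Q)
    {P Q : ℝ × ℝ} (hP : P ∈ unitSquare) (hQ : Q ∈ unitSquare) {I J : DyadicInterval} {n : ℕ}
    (hI : I.level = n) (hJ : J.level = n) (hPI : P ∈ I.toSet ×ˢ J.toSet)
    (hQI : Q ∈ I.toSet ×ˢ J.toSet) (h : κ P ≤ n ∨ κ Q ≤ n) : κ P = κ Q := by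
  wlog hPn : κ P ≤ n generalizing P Q
  · exact (this hQ hP hQI hPI h.symm (h.resolve_left hPn)).symm
  by_contra hne
  have h1 := hL P hP Q hQ
  rw [hκ P hP, hκ Q hQ] at h1
  have h2 := (le_dyadicDist_of_ne hne).trans h1
  have h3 := dyadicDistSq_le (hI.trans hJ.symm) hPI hQI
  have h4 : I.length = 1 / 2 ^ n := by rw [DyadicInterval.length, hI]
  have h5 : (1 : ℝ) / 2 ^ n ≤ 1 / 2 ^ κ P := by
    rw [one_div_le_one_div (by positivity) (by positivity)]
    exact pow_le_pow_right₀ (by norm_num) hPn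
  have h6 : (0 : ℝ) < 1 / 2 ^ n := by positivity
  linarith

theorem length_div_length_le_iff (I J : DyadicInterval) (k : ℕ) :
    J.length / I.length ≤ 1 / 2 ^ k ↔ I.level + k ≤ J.level := by
  unfold DyadicInterval.length
  rw [div_div_eq_mul_div, div_one, one_div_mul_eq_div, div_le_div_iff₀ (by positivity)
    (by positivity), one_mul, ← pow_add, pow_le_pow_iff_right₀ (by norm_num)]

end Lipschitz

section Cells

/-- The dyadic square of generation `N` with the given pair of positions. -/
def cell (N : ℕ) (c : Fin (2 ^ N) × Fin (2 ^ N)) : Set (ℝ × ℝ) :=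
  (DyadicInterval.mk N c.1).toSet ×ˢ (DyadicInterval.mk N c.2).toSet

theorem exists_mem_toSet (N : ℕ) {x : ℝ} (hx : x ∈ Set.Ioc (0 : ℝ) 1) :
    ∃ a, x ∈ (DyadicInterval.mk N a).toSet := by
  have h2 : (0 : ℝ) < 2 ^ N := by positivity
  have hpos : 0 < ⌈x * 2 ^ N⌉₊ := Nat.ceil_pos.2 (mul_pos hx.1 h2)
  have hle : ⌈x * 2 ^ N⌉₊ ≤ 2 ^ N := by
    rw [Nat.ceil_le]; push_cast; nlinarith [hx.2]
  obtain ⟨m, hm⟩ : ∃ m, ⌈x * 2 ^ N⌉₊ = m + 1 := Nat.exists_eq_succ_of_ne_zero hpos.ne'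
  refine ⟨⟨m, by omega⟩, ?_⟩
  have h3 := (Nat.ceil_eq_iff (by omega)).1 hm
  simp only [Nat.add_sub_cancel, Nat.cast_add, Nat.cast_one] at h3
  simp only [DyadicInterval.toSet, DyadicInterval.length_mk]
  rw [Set.mem_Ioc, mul_one_div, mul_one_div, div_lt_iff₀ h2, le_div_iff₀ h2]
  exact h3

theorem toSet_subset_Ioc (I : DyadicInterval) : I.toSet ⊆ Set.Ioc 0 1 := by
  intro x hx
  have hl := I.length_pos
  refine ⟨lt_of_le_of_lt (by positivity) hx.1, hx.2.trans ?_⟩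
  unfold DyadicInterval.length
  rw [mul_one_div, div_le_one (by positivity)]
  have := I.index.2
  exact_mod_cast this

theorem toSet_index_unique {N : ℕ} {a a' : Fin (2 ^ N)} {x : ℝ}
    (h : x ∈ (DyadicInterval.mk N a).toSet) (h' : x ∈ (DyadicInterval.mk N a').toSet) :
    a = a' := by
  have := (DyadicInterval.mem_toSet_iff h (I := DyadicInterval.mk N a') le_rfl).1 h'
  simpa [Fin.ext_iff] using this

theorem iUnion_cell (N : ℕ) : ⋃ c, cell N c = unitSquare := by
  ext ⟨x, y⟩
  simp only [Set.mem_iUnion, cell, unitSquare, Set.mem_prod]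
  constructor
  · rintro ⟨c, h1, h2⟩
    exact ⟨toSet_subset_Ioc _ h1, toSet_subset_Ioc _ h2⟩
  · rintro ⟨h1, h2⟩
    obtain ⟨a, ha⟩ := exists_mem_toSet N h1
    obtain ⟨b, hb⟩ := exists_mem_toSet N h2
    exact ⟨(a, b), ha, hb⟩

theorem cell_subset (N : ℕ) (c) : cell N c ⊆ unitSquare := by
  rw [← iUnion_cell N]; exact Set.subset_iUnion _ c

theorem pairwise_disjoint_cell (N : ℕ) : Pairwise (Function.onFun Disjoint (cell N)) := by
  intro c c' hne
  rw [Function.onFun, Set.disjoint_left]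
  rintro P ⟨h1, h2⟩ ⟨h1', h2'⟩
  exact hne (Prod.ext (toSet_index_unique h1 h1') (toSet_index_unique h2 h2'))

theorem measurableSet_cell (N : ℕ) (c) : MeasurableSet (cell N c) :=
  measurableSet_Ioc.prod measurableSet_Ioc

theorem volume_cell (N : ℕ) (c) : volume (cell N c) = ENNReal.ofReal (1 / 2 ^ N * (1 / 2 ^ N)) := by
  have h : ∀ a : Fin (2 ^ N), volume (DyadicInterval.mk N a).toSet = ENNReal.ofReal (1 / 2 ^ N) :=
    fun a => by
      rw [DyadicInterval.toSet, Real.volume_Ioc, DyadicInterval.length_mk]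
      congr 1; ring
  rw [cell, Measure.volume_eq_prod, Measure.prod_prod, h, h, ENNReal.ofReal_mul (by positivity)]

/-- The representative point of a dyadic square. -/
noncomputable def cellPoint (N : ℕ) (c : Fin (2 ^ N) × Fin (2 ^ N)) : ℝ × ℝ :=
  (gridPoint N c.1, gridPoint N c.2)

theorem cellPoint_mem (N : ℕ) (c) : cellPoint N c ∈ cell N c :=
  ⟨gridPoint_mem N c.1, gridPoint_mem N c.2⟩

/-- A function on the unit square that is constant on the dyadic squares of generation `N`. -/
def IsStep {α : Type*} (N : ℕ) (φ : ℝ × ℝ → α) : Prop :=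
  ∀ c, ∀ P ∈ cell N c, φ P = φ (cellPoint N c)

instance : IsFiniteMeasure squareMeasure := by
  refine ⟨?_⟩
  rw [squareMeasure, Measure.restrict_apply_univ, unitSquare, Measure.volume_eq_prod,
    Measure.prod_prod]
  simp

theorem squareMeasure_univ : squareMeasure Set.univ = 1 := by
  rw [squareMeasure, Measure.restrict_apply_univ, unitSquare, Measure.volume_eq_prod,
    Measure.prod_prod]
  simp

theorem lintegral_squareMeasure (N : ℕ) (φ : ℝ × ℝ → ℝ≥0∞) :
    ∫⁻ P, φ P ∂squareMeasure = ∑ c, ∫⁻ P in cell N c, φ P := by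
  rw [squareMeasure, ← iUnion_cell N,
    lintegral_iUnion (measurableSet_cell N) (pairwise_disjoint_cell N), tsum_fintype]

theorem IsStep.lintegral {N : ℕ} {φ : ℝ × ℝ → ℝ≥0∞} (hφ : IsStep N φ) :
    ∫⁻ P, φ P ∂squareMeasure =
      ENNReal.ofReal (1 / 2 ^ N * (1 / 2 ^ N)) * ∑ c, φ (cellPoint N c) := by
  rw [lintegral_squareMeasure N, Finset.mul_sum]
  refine Finset.sum_congr rfl fun c _ => ?_
  rw [setLIntegral_congr_fun (measurableSet_cell N c) (hφ c), setLIntegral_const, volume_cell,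
    mul_comm]

theorem IsStep.memLp {N : ℕ} {φ : ℝ × ℝ → ℂ} (hφ : IsStep N φ) (p : ℝ≥0∞) :
    MemLp φ p squareMeasure := by
  have h : MemLp (fun P => ∑ c, (cell N c).indicator (fun _ => φ (cellPoint N c)) P) p
      squareMeasure :=
    memLp_finsetSum _ fun c _ =>
      memLp_indicator_const p (measurableSet_cell N c) _ (Or.inr (measure_ne_top _ _))
  refine h.ae_eq ?_
  filter_upwards [ae_restrict_mem (measurableSet_Ioc.prod measurableSet_Ioc)] with P hP
  have hP' : P ∈ ⋃ c, cell N c := by rw [iUnion_cell]; exact hP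
  obtain ⟨c, hc⟩ := Set.mem_iUnion.1 hP'
  rw [Finset.sum_eq_single c, Set.indicator_of_mem hc, hφ c P hc]
  · intro c' _ hne
    exact Set.indicator_of_notMem
      (Set.disjoint_left.1 (pairwise_disjoint_cell N hne.symm) hc) _
  · simp

/-- The average of `f` over a dyadic square. -/
noncomputable def gridAverage (N : ℕ) (f : ℝ × ℝ → ℂ) (a b : Fin (2 ^ N)) : ℂ :=
  2 ^ N * 2 ^ N * ∫ P in cell N (a, b), f P

theorem haar_eq_of_mem {N : ℕ} {a : Fin (2 ^ N)} {x : ℝ}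
    (hx : x ∈ (DyadicInterval.mk N a).toSet) {I : DyadicInterval} (hI : I.level < N) :
    I.haar x = I.haar (gridPoint N a) := by
  rw [DyadicInterval.haar_eq_haarSign hx hI,
    DyadicInterval.haar_eq_haarSign (gridPoint_mem N a) hI]

theorem haarCoeff_eq_gridCoeff {N : ℕ} {f : ℝ × ℝ → ℂ} (hf : IntegrableOn f unitSquare)
    {I J : DyadicInterval} (hI : I.level < N) (hJ : J.level < N) :
    haarCoeff f I J = gridCoeff N (gridAverage N f) I J := by
  have hc : ∀ c, Set.EqOn (fun P : ℝ × ℝ => f P * ((I.haar P.1 * J.haar P.2 : ℝ) : ℂ))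
      (fun P => f P * ((I.haar (gridPoint N c.1) * J.haar (gridPoint N c.2) : ℝ) : ℂ))
      (cell N c) := fun c P hP => by
    simp only
    rw [haar_eq_of_mem hP.1 hI, haar_eq_of_mem hP.2 hJ]
  have hint : ∀ c, IntegrableOn f (cell N c) := fun c => hf.mono_set (cell_subset N c)
  unfold haarCoeff gridCoeff gridAverage
  rw [← iUnion_cell N, integral_iUnion_fintype (measurableSet_cell N) (pairwise_disjoint_cell N)
    (fun c => IntegrableOn.congr_fun ((hint c).mul_const _) (hc c).symm (measurableSet_cell N c)),
    Fintype.sum_prod_type, Finset.mul_sum]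
  refine Finset.sum_congr rfl fun a _ => ?_
  rw [Finset.mul_sum, Finset.mul_sum]
  refine Finset.sum_congr rfl fun b _ => ?_
  rw [setIntegral_congr_fun (measurableSet_cell N _) (hc (a, b)), integral_mul_const]
  field_simp

/-- Jensen's inequality for the average over a dyadic square. -/
theorem enorm_gridAverage_rpow_le {N : ℕ} {f : ℝ × ℝ → ℂ} {p : ℝ≥0∞} (hp : 1 ≤ p) (hp' : p ≠ ∞)
    (hf : MemLp f p squareMeasure) (c : Fin (2 ^ N) × Fin (2 ^ N)) :
    ENNReal.ofReal (1 / 2 ^ N * (1 / 2 ^ N)) * ‖gridAverage N f c.1 c.2‖ₑ ^ p.toReal ≤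
      ∫⁻ P in cell N c, ‖f P‖ₑ ^ p.toReal := by
  have hp0 : 0 < p.toReal := ENNReal.toReal_pos (by positivity) hp'
  set V := ENNReal.ofReal (1 / 2 ^ N * (1 / 2 ^ N)) with hV
  have hV0 : V ≠ 0 := by
    rw [hV, ne_eq, ENNReal.ofReal_eq_zero, not_le]; positivity
  have hVt : V ≠ ∞ := ENNReal.ofReal_ne_top
  have hfm : AEStronglyMeasurable f (volume.restrict (cell N c)) :=
    hf.1.mono_measure (Measure.restrict_mono (cell_subset N c) le_rfl)
  have h1 := eLpNorm_le_eLpNorm_mul_rpow_measure_univ hp hfm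
  rw [Measure.restrict_apply_univ, volume_cell, ← hV, eLpNorm_one_eq_lintegral_enorm,
    eLpNorm_eq_lintegral_rpow_enorm_toReal (by positivity) hp', ENNReal.toReal_one, div_one] at h1
  set A := ∫⁻ P in cell N c, ‖f P‖ₑ ^ p.toReal with hA
  have h2 : ‖gridAverage N f c.1 c.2‖ₑ ≤ V⁻¹ * (A ^ (1 / p.toReal) * V ^ (1 - 1 / p.toReal)) := by
    rw [gridAverage, enorm_mul]
    gcongr
    · apply le_of_eq
      rw [hV, ← ENNReal.ofReal_inv_of_pos (by positivity), ← ofReal_norm]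
      congr 1
      simp
    · exact (enorm_integral_le_lintegral_enorm _).trans h1
  calc V * ‖gridAverage N f c.1 c.2‖ₑ ^ p.toReal
      ≤ V * (V⁻¹ * (A ^ (1 / p.toReal) * V ^ (1 - 1 / p.toReal))) ^ p.toReal := by gcongr
    _ = V * (A ^ (1 / p.toReal) * V ^ (- (1 / p.toReal))) ^ p.toReal := by
        congr 2
        rw [mul_left_comm, ← ENNReal.rpow_neg_one V, ← ENNReal.rpow_add _ _ hV0 hVt]
        congr 2; ring
    _ = V * (A * V⁻¹) := by
        rw [ENNReal.mul_rpow_of_nonneg _ _ hp0.le, ← ENNReal.rpow_mul, ← ENNReal.rpow_mul,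
          one_div_mul_cancel hp0.ne', ENNReal.rpow_one, neg_mul, one_div_mul_cancel hp0.ne',
          ENNReal.rpow_neg_one]
    _ = A := by
        rw [mul_left_comm, ENNReal.mul_inv_cancel hV0 hVt, mul_one]

end Cells

/-! ### Uniform bounds for finite partial sums -/

section Bound

/-- The hypotheses on `v`: its values are negative powers of two, and it is Lipschitz with constant
`1 / 2` for the dyadic distances. -/
structure IsDyadicLipschitz (v : ℝ × ℝ → ℝ) : Prop where
  value : ∀ P ∈ unitSquare, ∃ k : ℕ, v P = 1 / 2 ^ k
  dist_le : ∀ P ∈ unitSquare, ∀ Q ∈ unitSquare,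
    dyadicDist (v P) (v Q) ≤ 1 / 2 * dyadicDistSq P Q

theorem haarTerm_eq {v : ℝ × ℝ → ℝ} {κ : ℝ × ℝ → ℕ} (hκ : ∀ P ∈ unitSquare, v P = 1 / 2 ^ κ P)
    (f : ℝ × ℝ → ℂ) (s : DyadicInterval × DyadicInterval) {P : ℝ × ℝ} (hP : P ∈ unitSquare) :
    haarTerm v f s P = if s.1.level + κ P ≤ s.2.level then
      haarCoeff f s.1 s.2 * ((s.1.haar P.1 * s.2.haar P.2 : ℝ) : ℂ) else 0 := by
  unfold haarTerm
  rw [hκ P hP]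
  exact if_congr (length_div_length_le_iff _ _ _) rfl rfl

theorem isStep_haarTerm {v : ℝ × ℝ → ℝ} (hv : IsDyadicLipschitz v) (f : ℝ × ℝ → ℂ)
    {s : DyadicInterval × DyadicInterval} {N : ℕ} (h1 : s.1.level < N) (h2 : s.2.level < N) :
    IsStep N (haarTerm v f s) := by
  choose! κ hκ using hv.value
  intro c P hP
  have hPs := cell_subset N c hP
  have hQs := cell_subset N c (cellPoint_mem N c)
  rw [haarTerm_eq hκ f s hPs, haarTerm_eq hκ f s hQs, haar_eq_of_mem hP.1 h1,
    haar_eq_of_mem hP.2 h2]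
  refine if_congr ?_ rfl rfl
  by_cases h : κ P ≤ N ∨ κ (cellPoint N c) ≤ N
  · rw [exponent_eq_of_mem_square (I := ⟨N, c.1⟩) (J := ⟨N, c.2⟩) hκ hv.dist_le hPs hQs rfl rfl hP
      (cellPoint_mem N c) h]
  · constructor <;> intro <;> omega

theorem exists_level_lt (S : Finset (DyadicInterval × DyadicInterval)) :
    ∃ N : ℕ, ∀ s ∈ S, s.1.level < N ∧ s.2.level < N := by
  refine ⟨S.sup (fun s => max s.1.level s.2.level) + 1, fun s hs => ?_⟩
  have := Finset.le_sup (f := fun s : DyadicInterval × DyadicInterval =>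
    max s.1.level s.2.level) hs
  omega

theorem memLp_haarTerm {v : ℝ × ℝ → ℝ} (hv : IsDyadicLipschitz v) (f : ℝ × ℝ → ℂ)
    (s : DyadicInterval × DyadicInterval) (p : ℝ≥0∞) : MemLp (haarTerm v f s) p squareMeasure := by
  obtain ⟨N, hN⟩ := exists_level_lt {s}
  exact (isStep_haarTerm hv f (hN s (by simp)).1 (hN s (by simp)).2).memLp p

theorem enorm_rpow_eq (z : ℂ) {q : ℝ} (hq : 0 ≤ q) :
    ‖z‖ₑ ^ (2 * q) = ENNReal.ofReal ((‖z‖ ^ 2) ^ q) := by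
  rw [← Real.rpow_natCast_mul (norm_nonneg z), ← ofReal_norm,
    ENNReal.ofReal_rpow_of_nonneg (norm_nonneg z) (by linarith)]
  norm_num

theorem mem_toSet_ancestor {N n : ℕ} (hn : n ≤ N) (a : Fin (2 ^ N)) :
    gridPoint N a ∈ (ancestor N n a).toSet :=
  (ancestor_eq_iff (I := ancestor N n a) hn).1 rfl

/-- The grid bound, applied to the cell averages of `f`, gives a bound in `L^p` that is uniform
over all finite sets of terms. -/
theorem exists_eLpNorm_sum_haarTerm_le {p : ℝ≥0∞} (hp : 1 < p) (hp' : p ≠ ∞) : ∃ C : ℝ≥0,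
    ∀ v, IsDyadicLipschitz v → ∀ f : ℝ × ℝ → ℂ, MemLp f p squareMeasure →
      ∀ S : Finset (DyadicInterval × DyadicInterval),
        eLpNorm (fun P => ∑ s ∈ S, haarTerm v f s P) p squareMeasure ≤
          C * eLpNorm f p squareMeasure := by
  have hp1 : 1 < p.toReal := by
    rw [← ENNReal.toReal_one]
    exact (ENNReal.toReal_lt_toReal ENNReal.one_ne_top hp').2 hp
  obtain ⟨q, hq⟩ : ∃ q, p.toReal = 2 * q := ⟨p.toReal / 2, by ring⟩
  have hq2 : 1 / 2 < q := by linarith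
  have hq0 : 0 ≤ q := by linarith
  obtain ⟨C, hC, h⟩ := grid_truncated_le hq2
  refine ⟨C.toNNReal ^ (1 / p.toReal), fun v hv f hf S => ?_⟩
  obtain ⟨N, hN⟩ := exists_level_lt S
  have hfi : IntegrableOn f unitSquare := hf.integrable hp.le
  choose! κ hκ using hv.value
  have hmem : ∀ a b, (gridPoint N a, gridPoint N b) ∈ unitSquare := fun a b =>
    cell_subset N (a, b) (cellPoint_mem N (a, b))
  have hgrid := h N (gridAverage N f) S (fun a b => κ (gridPoint N a, gridPoint N b)) hN
    (fun a b n hn hκn => by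
      -- two points that differ in the digit of generation `n` share an interval of generation `n`
      have ha := mem_toSet_ancestor hn.le a
      have hb := mem_toSet_ancestor hn.le b
      have hb' : gridPoint N (flip N n b) ∈ (ancestor N n b).toSet :=
        (ancestor_eq_iff (I := ancestor N n b) hn.le).1 (ancestor_flip hn le_rfl b)
      exact (exponent_eq_of_mem_square (I := ancestor N n a) (J := ancestor N n b) hκ hv.dist_le
        (hmem _ _) (hmem _ _) rfl rfl ⟨ha, hb⟩ ⟨ha, hb'⟩ hκn).symm)
  set T : ℝ × ℝ → ℂ := fun P => ∑ s ∈ S, haarTerm v f s P with hT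
  have hTstep : IsStep N (fun P => ‖T P‖ₑ ^ p.toReal) := fun c P hP => by
    simp only [hT]
    rw [Finset.sum_congr rfl fun s hs =>
      isStep_haarTerm hv f (hN s hs).1 (hN s hs).2 c P hP]
  have hTgrid : ∀ a b, T (gridPoint N a, gridPoint N b) =
      ∑ s ∈ S, if s.1.level + κ (gridPoint N a, gridPoint N b) ≤ s.2.level then
        gridCoeff N (gridAverage N f) s.1 s.2 *
          ((s.1.haar (gridPoint N a) * s.2.haar (gridPoint N b) : ℝ) : ℂ) else 0 := fun a b => by
    simp only [hT]
    refine Finset.sum_congr rfl fun s hs => ?_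
    rw [haarTerm_eq hκ f s (hmem a b), haarCoeff_eq_gridCoeff hfi (hN s hs).1 (hN s hs).2]
  simp only [← hTgrid] at hgrid
  have hnn : ∀ z : ℂ, 0 ≤ (‖z‖ ^ 2) ^ q := fun z => by positivity
  have hsum : ∑ c, ‖T (cellPoint N c)‖ₑ ^ p.toReal ≤
      ENNReal.ofReal C * ∑ c : Fin (2 ^ N) × Fin (2 ^ N), ‖gridAverage N f c.1 c.2‖ₑ ^ p.toReal := by
    simp only [hq, enorm_rpow_eq _ hq0]
    rw [← ENNReal.ofReal_sum_of_nonneg fun c _ => hnn _,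
      ← ENNReal.ofReal_sum_of_nonneg fun c _ => hnn _, ← ENNReal.ofReal_mul hC,
      Fintype.sum_prod_type, Fintype.sum_prod_type]
    exact ENNReal.ofReal_le_ofReal hgrid
  have hint : ∫⁻ P, ‖T P‖ₑ ^ p.toReal ∂squareMeasure ≤
      ENNReal.ofReal C * ∫⁻ P, ‖f P‖ₑ ^ p.toReal ∂squareMeasure := by
    rw [hTstep.lintegral, lintegral_squareMeasure N]
    calc _ ≤ ENNReal.ofReal (1 / 2 ^ N * (1 / 2 ^ N)) *
          (ENNReal.ofReal C * ∑ c : Fin (2 ^ N) × Fin (2 ^ N), ‖gridAverage N f c.1 c.2‖ₑ ^ p.toReal) := by gcongr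
      _ = ENNReal.ofReal C * ∑ c : Fin (2 ^ N) × Fin (2 ^ N), ENNReal.ofReal (1 / 2 ^ N * (1 / 2 ^ N)) *
          ‖gridAverage N f c.1 c.2‖ₑ ^ p.toReal := by rw [mul_left_comm, Finset.mul_sum]
      _ ≤ _ := by
        gcongr with c _
        exact enorm_gridAverage_rpow_le hp.le hp' hf c
  have hp0 : p ≠ 0 := (zero_lt_one.trans hp).ne'
  rw [eLpNorm_eq_lintegral_rpow_enorm_toReal hp0 hp',
    eLpNorm_eq_lintegral_rpow_enorm_toReal hp0 hp',
    ENNReal.coe_rpow_of_nonneg _ (by positivity),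
    ← ENNReal.mul_rpow_of_nonneg _ _ (by positivity)]
  gcongr
  exact hint

end Bound

/-! ### Density of step functions -/

section Density

/-- Rounding up to the next multiple of `1 / 2 ^ N`. -/
noncomputable def dyadicCeil (N : ℕ) (x : ℝ) : ℝ := ⌈x * 2 ^ N⌉ / 2 ^ N

theorem dyadicCeil_eq {N : ℕ} {a : Fin (2 ^ N)} {x : ℝ}
    (hx : x ∈ (DyadicInterval.mk N a).toSet) : dyadicCeil N x = gridPoint N a := by
  have h2 : (0 : ℝ) < 2 ^ N := by positivity
  simp only [DyadicInterval.toSet, DyadicInterval.length_mk] at hx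
  rw [Set.mem_Ioc, mul_one_div, mul_one_div, div_lt_iff₀ h2, le_div_iff₀ h2] at hx
  have : ⌈x * 2 ^ N⌉ = ((a : ℕ) : ℤ) + 1 := by
    rw [Int.ceil_eq_iff]
    push_cast
    exact ⟨by linarith [hx.1], hx.2⟩
  rw [dyadicCeil, this, gridPoint]
  push_cast
  ring

/-- Dyadic step functions are dense in `L^p`: a continuous function is close to its values at the
upper right corners of small dyadic squares. -/
theorem exists_isStep_eLpNorm_sub_le {p : ℝ≥0∞} (hp : 1 ≤ p) (hp' : p ≠ ∞) {f : ℝ × ℝ → ℂ}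
    (hf : MemLp f p squareMeasure) {ε : ℝ≥0∞} (hε : ε ≠ 0) :
    ∃ (N : ℕ) (φ : ℝ × ℝ → ℂ), IsStep N φ ∧ eLpNorm (f - φ) p squareMeasure ≤ ε := by
  obtain ⟨η, hη0, hη⟩ : ∃ η : ℝ, 0 < η ∧ ENNReal.ofReal η ≤ ε / 2 := by
    rcases eq_or_ne ε ∞ with rfl | hεt
    · exact ⟨1, one_pos, by simp [ENNReal.top_div]⟩
    · refine ⟨(ε / 2).toReal, ENNReal.toReal_pos (by simpa using hε) ?_, ENNReal.ofReal_toReal_le⟩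
      exact ENNReal.div_ne_top hεt (by norm_num)
  obtain ⟨g, -, hfg, hgc, hg⟩ := hf.exists_hasCompactSupport_eLpNorm_sub_le hp'
    (ε := ε / 2) (by simpa using hε)
  have huc : UniformContinuousOn g (Set.Icc (0 : ℝ) 1 ×ˢ Set.Icc (0 : ℝ) 1) :=
    (isCompact_Icc.prod isCompact_Icc).uniformContinuousOn_of_continuous hgc.continuousOn
  obtain ⟨δ, hδ0, hδ⟩ := Metric.uniformContinuousOn_iff_le.1 huc η hη0
  obtain ⟨N, hN⟩ := exists_pow_lt_of_lt_one hδ0 (by norm_num : (1 / 2 : ℝ) < 1)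
  have hround : ∀ x ∈ Set.Ioc (0 : ℝ) 1, x ∈ Set.Icc (0 : ℝ) 1 ∧
      dyadicCeil N x ∈ Set.Icc (0 : ℝ) 1 ∧ dist x (dyadicCeil N x) ≤ δ := by
    intro x hx
    obtain ⟨a, ha⟩ := exists_mem_toSet N hx
    rw [dyadicCeil_eq ha]
    refine ⟨Set.Ioc_subset_Icc_self hx,
      Set.Ioc_subset_Icc_self (toSet_subset_Ioc _ (gridPoint_mem N a)), ?_⟩
    have h1 := ha.1
    have h2 := ha.2
    simp only [DyadicInterval.length_mk] at h1 h2
    rw [dist_comm, Real.dist_eq, gridPoint, abs_of_nonneg (by linarith)]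
    rw [one_div_pow] at hN
    linarith
  set φ : ℝ × ℝ → ℂ := fun P => g (dyadicCeil N P.1, dyadicCeil N P.2) with hφ
  have hφs : IsStep N φ := fun c P hP => by
    simp only [hφ, cellPoint]
    rw [dyadicCeil_eq hP.1, dyadicCeil_eq hP.2, dyadicCeil_eq (gridPoint_mem N c.1),
      dyadicCeil_eq (gridPoint_mem N c.2)]
  have hgφ : eLpNorm (g - φ) p squareMeasure ≤ ε / 2 := by
    have hb : ∀ᵐ P ∂squareMeasure, ‖(g - φ) P‖ ≤ η := by
      filter_upwards [ae_restrict_mem (measurableSet_Ioc.prod measurableSet_Ioc)] with P hP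
      obtain ⟨a1, a2, a3⟩ := hround P.1 hP.1
      obtain ⟨b1, b2, b3⟩ := hround P.2 hP.2
      rw [Pi.sub_apply, ← dist_eq_norm]
      exact hδ P ⟨a1, b1⟩ _ ⟨a2, b2⟩ (by rw [Prod.dist_eq]; exact max_le a3 b3)
    have := eLpNorm_le_of_ae_bound (p := p) hb
    rw [squareMeasure_univ, ENNReal.one_rpow, one_mul] at this
    exact this.trans hη
  refine ⟨N, φ, hφs, ?_⟩
  calc eLpNorm (f - φ) p squareMeasure = eLpNorm ((f - g) + (g - φ)) p squareMeasure := by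
        congr 1; abel
    _ ≤ eLpNorm (f - g) p squareMeasure + eLpNorm (g - φ) p squareMeasure :=
        eLpNorm_add_le (hf.sub hg).1 (hg.sub (hφs.memLp p)).1 hp
    _ ≤ ε / 2 + ε / 2 := add_le_add hfg hgφ
    _ = ε := ENNReal.add_halves ε

end Density

/-! ### Unconditional convergence -/

section Convergence

theorem gridAverage_of_isStep {N : ℕ} {φ : ℝ × ℝ → ℂ} (hφ : IsStep N φ) (a b : Fin (2 ^ N)) :
    gridAverage N φ a b = φ (gridPoint N a, gridPoint N b) := by
  rw [gridAverage, setIntegral_congr_fun (measurableSet_cell N (a, b)) (hφ (a, b)),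
    setIntegral_const, Measure.real, volume_cell, ENNReal.toReal_ofReal (by positivity)]
  simp only [cellPoint, Complex.real_smul]
  push_cast
  field_simp

/-- A function that is constant on the dyadic squares of generation `N` has no Haar coefficients of
generation at least `N` in one of the variables. -/
theorem haarCoeff_eq_zero_of_isStep {N : ℕ} {φ : ℝ × ℝ → ℂ} (hφ : IsStep N φ)
    {I J : DyadicInterval} (h : N ≤ I.level ∨ N ≤ J.level) : haarCoeff φ I J = 0 := by
  obtain ⟨M, hM⟩ : ∃ M, N ≤ M ∧ I.level < M ∧ J.level < M :=
    ⟨max N (max I.level J.level) + 1, by omega, by omega, by omega⟩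
  obtain ⟨hNM, hI, hJ⟩ := hM
  have hφi : IntegrableOn φ unitSquare := (hφ.memLp 1).integrable le_rfl
  -- the values of `φ` on the finer grid only depend on the ancestors of generation `N`
  have hval : ∀ a b a' b' : Fin (2 ^ M), ancestor M N a = ancestor M N a' →
      ancestor M N b = ancestor M N b' →
      φ (gridPoint M a, gridPoint M b) = φ (gridPoint M a', gridPoint M b') := by
    intro a b a' b' ha hb
    have h1 : ∀ a b : Fin (2 ^ M), (gridPoint M a, gridPoint M b) ∈
        cell N ((ancestor M N a).index, (ancestor M N b).index) := fun a b =>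
      ⟨mem_toSet_ancestor hNM a, mem_toSet_ancestor hNM b⟩
    have h2 : (gridPoint M a', gridPoint M b') ∈
        cell N ((ancestor M N a).index, (ancestor M N b).index) := by
      have h3 := mem_toSet_ancestor hNM a'
      have h4 := mem_toSet_ancestor hNM b'
      rw [← ha] at h3
      rw [← hb] at h4
      exact ⟨h3, h4⟩
    rw [hφ _ _ (h1 a b), hφ _ _ h2]
  have hφM : IsStep M φ := by
    intro c P hP
    have hx : ∀ {x : ℝ} {a : Fin (2 ^ M)}, x ∈ (DyadicInterval.mk M a).toSet →
        x ∈ (ancestor M N a).toSet := fun {x a} hx =>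
      (DyadicInterval.mem_toSet_iff hx (I := ancestor M N a) hNM).2 rfl
    rw [hφ ((ancestor M N c.1).index, (ancestor M N c.2).index) P ⟨hx hP.1, hx hP.2⟩,
      hφ ((ancestor M N c.1).index, (ancestor M N c.2).index) (cellPoint M c)
        ⟨mem_toSet_ancestor hNM c.1, mem_toSet_ancestor hNM c.2⟩]
  rw [haarCoeff_eq_gridCoeff hφi hI hJ, gridCoeff]
  simp only [gridAverage_of_isStep hφM]
  rw [mul_eq_zero]
  right
  rcases h with h | h
  · rw [← self_eq_neg, ← Finset.sum_neg_distrib]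
    conv_lhs => rw [← Equiv.sum_comp (flip M I.level)]
    refine Finset.sum_congr rfl fun a _ => ?_
    rw [← mul_neg, ← Finset.sum_neg_distrib]
    congr 1
    refine Finset.sum_congr rfl fun b _ => ?_
    rw [haar_flip_self hI, hval _ b a b (ancestor_flip hI h a) rfl]
    push_cast; ring
  · refine Finset.sum_eq_zero fun a _ => ?_
    rw [mul_eq_zero]
    right
    rw [← self_eq_neg, ← Finset.sum_neg_distrib]
    conv_lhs => rw [← Equiv.sum_comp (flip M J.level)]
    refine Finset.sum_congr rfl fun b _ => ?_
    rw [haar_flip_self hJ, hval a _ a b rfl (ancestor_flip hJ h b)]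
    push_cast; ring

theorem haarCoeff_sub {f g : ℝ × ℝ → ℂ} (hf : IntegrableOn f unitSquare)
    (hg : IntegrableOn g unitSquare) (I J : DyadicInterval) :
    haarCoeff (f - g) I J = haarCoeff f I J - haarCoeff g I J := by
  obtain ⟨N, hN⟩ := exists_level_lt {(I, J)}
  obtain ⟨hI, hJ⟩ := hN (I, J) (by simp)
  rw [haarCoeff_eq_gridCoeff hf hI hJ, haarCoeff_eq_gridCoeff hg hI hJ,
    haarCoeff_eq_gridCoeff (hf.sub hg) hI hJ]
  have : ∀ a b, gridAverage N (f - g) a b = gridAverage N f a b - gridAverage N g a b :=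
    fun a b => by
      simp only [gridAverage, Pi.sub_apply]
      rw [integral_sub (hf.mono_set (cell_subset N _)) (hg.mono_set (cell_subset N _)), mul_sub]
  simp only [gridCoeff, this, sub_mul, Finset.sum_sub_distrib, mul_sub]

theorem exists_finset_level_lt (N : ℕ) : ∃ S : Finset (DyadicInterval × DyadicInterval),
    ∀ I J : DyadicInterval, I.level < N → J.level < N → (I, J) ∈ S := by
  classical
  let L : Finset DyadicInterval := (Finset.range N).biUnion fun n =>
    Finset.univ.image (DyadicInterval.mk n)
  have hL : ∀ I : DyadicInterval, I.level < N → I ∈ L := fun I hI => by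
    simp only [L, Finset.mem_biUnion, Finset.mem_range, Finset.mem_image]
    exact ⟨I.level, hI, I.index, Finset.mem_univ _, rfl⟩
  exact ⟨L ×ˢ L, fun I J hI hJ => Finset.mem_product.2 ⟨hL I hI, hL J hJ⟩⟩

/-- The terms outside a large finite set only see the difference of `f` and a step function, so the
uniform bound for finite sums makes the tails small. -/
theorem exists_isHaarMultiplier {p : ℝ≥0∞} (hp : 1 < p) (hp' : p ≠ ∞) {v : ℝ × ℝ → ℝ}
    (hv : IsDyadicLipschitz v) {f : ℝ × ℝ → ℂ} (hf : MemLp f p squareMeasure) :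
    ∃ g, IsHaarMultiplier p v f g := by
  have : Fact (1 ≤ p) := ⟨hp.le⟩
  obtain ⟨C, hC⟩ := exists_eLpNorm_sum_haarTerm_le hp hp'
  let t : DyadicInterval × DyadicInterval → Lp ℂ p squareMeasure :=
    fun s => (memLp_haarTerm hv f s p).toLp
  have ht : ∀ S : Finset (DyadicInterval × DyadicInterval),
      (∑ s ∈ S, t s : Lp ℂ p squareMeasure) =ᵐ[squareMeasure]
        fun P => ∑ s ∈ S, haarTerm v f s P := fun S => by
    have h1 : ∀ᵐ P ∂squareMeasure, ∀ s ∈ S, t s P = haarTerm v f s P :=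
      (Finset.eventually_all S).2 fun s _ => (memLp_haarTerm hv f s p).coeFn_toLp
    filter_upwards [Lp.coeFn_fun_finsetSum S t, h1] with P h2 h3
    rw [h2]
    exact Finset.sum_congr rfl fun s hs => h3 s hs
  have hsum : Summable t := by
    rw [summable_iff_vanishing_norm]
    intro ε hε
    have hδ : ENNReal.ofReal (ε / 2) / (C + 1) ≠ 0 := by
      refine ENNReal.div_ne_zero.2 ⟨?_, by finiteness⟩
      rw [ne_eq, ENNReal.ofReal_eq_zero, not_le]; linarith
    obtain ⟨N, φ, hφ, hφε⟩ := exists_isStep_eLpNorm_sub_le hp.le hp' hf hδ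
    obtain ⟨S₀, hS₀⟩ := exists_finset_level_lt N
    have hfi : IntegrableOn f unitSquare := hf.integrable hp.le
    have hφi : IntegrableOn φ unitSquare := (hφ.memLp 1).integrable le_rfl
    refine ⟨S₀, fun S hS => ?_⟩
    have e1 : (fun P => ∑ s ∈ S, haarTerm v f s P) =
        fun P => ∑ s ∈ S, haarTerm v (f - φ) s P := by
      funext P
      refine Finset.sum_congr rfl fun s hs => ?_
      have hlev : N ≤ s.1.level ∨ N ≤ s.2.level := by
        by_contra! hc
        exact Finset.disjoint_left.1 hS hs (hS₀ s.1 s.2 hc.1 hc.2)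
      unfold haarTerm
      rw [haarCoeff_sub hfi hφi, haarCoeff_eq_zero_of_isStep hφ hlev, sub_zero]
    have e2 : eLpNorm (fun P => ∑ s ∈ S, haarTerm v f s P) p squareMeasure ≤
        ENNReal.ofReal (ε / 2) := by
      rw [e1]
      calc _ ≤ C * eLpNorm (f - φ) p squareMeasure := hC v hv _ (hf.sub (hφ.memLp p)) S
        _ ≤ (C + 1) * (ENNReal.ofReal (ε / 2) / (C + 1)) := by
          gcongr
          exact le_self_add
        _ ≤ _ := ENNReal.mul_div_le
    rw [Lp.norm_def, eLpNorm_congr_ae (ht S)]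
    calc _ ≤ (ENNReal.ofReal (ε / 2)).toReal := ENNReal.toReal_mono ENNReal.ofReal_ne_top e2
      _ = ε / 2 := ENNReal.toReal_ofReal (by linarith)
      _ < ε := by linarith
  obtain ⟨g, hg⟩ := hsum
  refine ⟨g, Lp.memLp g, ?_⟩
  have := (Lp.tendsto_Lp_iff_tendsto_eLpNorm' _ _).1 hg
  refine (this : Tendsto _ _ _).congr fun S => ?_
  refine eLpNorm_congr_ae ?_
  filter_upwards [ht S] with P hP
  rw [Pi.sub_apply, hP]

theorem IsHaarMultiplier.eLpNorm_le {p : ℝ≥0∞} (hp : 1 ≤ p) {v : ℝ × ℝ → ℝ}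
    (hv : IsDyadicLipschitz v) {f g : ℝ × ℝ → ℂ} {C : ℝ≥0∞} (hg : IsHaarMultiplier p v f g)
    (hC : ∀ S : Finset (DyadicInterval × DyadicInterval),
      eLpNorm (fun P => ∑ s ∈ S, haarTerm v f s P) p squareMeasure ≤ C) :
    eLpNorm g p squareMeasure ≤ C := by
  have h := hg.2.const_add C
  rw [add_zero] at h
  refine ge_of_tendsto' h fun S => ?_
  have hS : MemLp (fun P => ∑ s ∈ S, haarTerm v f s P) p squareMeasure :=
    memLp_finsetSum _ fun s _ => memLp_haarTerm hv f s p
  calc eLpNorm g p squareMeasure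
      = eLpNorm ((fun P => ∑ s ∈ S, haarTerm v f s P) -
          fun P => (∑ s ∈ S, haarTerm v f s P) - g P) p squareMeasure := by
        congr 1
        funext P
        simp
    _ ≤ eLpNorm (fun P => ∑ s ∈ S, haarTerm v f s P) p squareMeasure +
          eLpNorm (fun P => (∑ s ∈ S, haarTerm v f s P) - g P) p squareMeasure :=
        eLpNorm_sub_le hS.1 (hS.sub hg.1).1 hp
    _ ≤ _ := by gcongr; exact hC S

end Convergence

end DyadicModel

theorem theorem1p3 (p : ℝ≥0∞) (hp : 1 < p) (hp' : p < ∞) :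
    ∃ C : ℝ≥0, ∀ v : ℝ × ℝ → ℝ,
      (∀ P ∈ DyadicModel.unitSquare, ∃ k : ℕ, v P = 1 / 2 ^ k) →
      (∀ P ∈ DyadicModel.unitSquare, ∀ Q ∈ DyadicModel.unitSquare,
        DyadicModel.dyadicDist (v P) (v Q) ≤ 1 / 2 * DyadicModel.dyadicDistSq P Q) →
      ∀ f : ℝ × ℝ → ℂ, MemLp f p DyadicModel.squareMeasure →
        (∃ g : ℝ × ℝ → ℂ, DyadicModel.IsHaarMultiplier p v f g) ∧
        ∀ g : ℝ × ℝ → ℂ, DyadicModel.IsHaarMultiplier p v f g →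
          eLpNorm g p DyadicModel.squareMeasure ≤ C * eLpNorm f p DyadicModel.squareMeasure := by
  obtain ⟨C, hC⟩ := DyadicModel.exists_eLpNorm_sum_haarTerm_le hp hp'.ne
  refine ⟨C, fun v hv hL f hf => ⟨DyadicModel.exists_isHaarMultiplier hp hp'.ne ⟨hv, hL⟩ hf,
    fun g hg => hg.eLpNorm_le hp.le ⟨hv, hL⟩ (hC v ⟨hv, hL⟩ f hf)⟩⟩
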